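/- Let $p,q,a,b,\mu\in\mathbb R$ with $b\neq 0$, $p^2+q^2\neq 0$ and $\mu\in(0,1)$. All functions are real valued. For $\sigma>0$ put $\boldsymbol D^{-\sigma}w(x)=\frac1{\Gamma(\sigma)}\int_{-\infty}^x (x-t)^{\sigma-1}w(t)\,dt$ and $\boldsymbol D^{-\sigma*}w(x)=\frac1{\Gamma(\sigma)}\int_x^{\infty}(t-x)^{\sigma-1}w(t)\,dt$. For $s>0$ and the integer $n$ with $n-1\le s<n$ put $\boldsymbol D^{s}\psi=\frac{d^n}{dx^n}\boldsymbol D^{-(n-s)}\psi$ and $\boldsymbol D^{s*}\psi=(-1)^n\frac{d^n}{dx^n}\boldsymbol D^{-(n-s)*}\psi$ for $\psi\in C_0^\infty(\mathbb R)$. For $v,w\in L^1_{loc}(\mathbb R)$, $w$ is the weak derivative $\boldsymbol D^s v$ (respectively $\boldsymbol D^{s*}v$) if $\int v\,\boldsymbol D^{s*}\psi=\int w\psi$ (respectively $\int v\,\boldsymbol D^{s}\psi=\int w\psi$) for all $\psi\in C_0^\infty(\mathbb R)$. $D$ denotes the usual weak derivative. For $s\ge 0$ let $\widehat H^s(\mathbb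 R)=\{w\in L^2(\mathbb R):\int_{\mathbb R}(1+|2\pi\xi|^{2s})|\widehat w(\xi)|^2\,d\xi<\infty\}$, where $\widehat w$ is the Plancherel transform, normalized by $\widehat w(\xi)=\int e^{-2\pi i x\xi}w(x)\,dx$ for $w\in L^1(\mathbb R)\cap L^2(\mathbb R)$. For $f\in L^2(\mathbb R)$ consider the problem: find $u\in\widehat H^{2-\mu}(\mathbb R)$ with $$p\,\boldsymbol D^{2-\mu}u+q\,\boldsymbol D^{(2-\mu)*}u+a\,Du+b\,u=f\quad\text{a.e. on }\mathbb R,\qquad(\ast)$$ all derivatives being weak derivatives. Set $\sigma_1=2-\mu$, $\sigma_2=\frac{3-\mu}2$, $\sigma_3=1$, $\sigma_4=\frac{2-\mu}2$, $\sigma_5=0$ and $C_1=p^2+q^2+2pq\cos(\sigma_1\pi)$, $C_2=2a(q-p)\cos(\sigma_2\pi)$, $C_3=a^2$, $C_4=2b(p+q)\cos(\sigma_4\pi)$, $C_5=b^2$. Assume that one of the following holds: (i) $C_2\ge0$ and $C_4\ge0$; (ii) $C_2\ge0$, $C_4<0$, and there is $\alpha>0$ with $b^2>-C_4\alpha^{2(\sigma_5-\sigma_4)}$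 and $\sum_{j=1}^4 C_j\alpha^{1-2\sigma_j}>0$; (iii) $C_2<0$, $C_4\ge0$, and there is $\alpha>0$ with $b^2>-\sum_{j=2}^4C_j\alpha^{2(\sigma_5-\sigma_j)}$ and $\sum_{j=1}^2 C_j\alpha^{1-2\sigma_j}>0$; (iv) $C_2<0$, $C_4<0$, and there is $\alpha>0$ with $b^2>-\sum_{j=2,4}C_j\alpha^{2(\sigma_5-\sigma_j)}$ and $\sum_{j=1,2,4} C_j\alpha^{1-2\sigma_j}>0$. If $f\in L^2(\mathbb R)\cap C^\infty(\mathbb R)$, then the solution $u\in\widehat H^{2-\mu}(\mathbb R)$ of $(\ast)$, which exists and is unique up to equality almost everywhere, belongs to $C^\infty(\mathbb R)$, that is, it coincides almost everywhere with a $C^\infty$ function. -/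

import Mathlib

open MeasureTheory FourierTransform
open scoped ContDiff

noncomputable section

/-- The left Riemann-Liouville integral of order `σ > 0` over the whole line,
`(1 / Γ(σ)) ∫_{-∞}^x (x - t)^(σ - 1) w(t) dt`. -/
def rlIntegralLeft (σ : ℝ) (w : ℝ → ℝ) (x : ℝ) : ℝ :=
  (Real.Gamma σ)⁻¹ * ∫ t in Set.Iic x, (x - t) ^ (σ - 1) * w t

/-- The right Riemann-Liouville integral of order `σ > 0` over the whole line,
`(1 / Γ(σ)) ∫_x^∞ (t - x)^(σ - 1) w(t) dt`. -/
def rlIntegralRight (σ : ℝ) (w : ℝ → ℝ) (x : ℝ) : ℝ :=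
  (Real.Gamma σ)⁻¹ * ∫ t in Set.Ici x, (t - x) ^ (σ - 1) * w t

/-- The smallest integer (strictly) greater than `s ≥ 0`. -/
def rlOrder (s : ℝ) : ℕ := ⌊s⌋₊ + 1

/-- The left Riemann-Liouville derivative of order `s > 0` over the whole line:
`(d/dx)^n` of the left integral of order `n - s`, with `n - 1 ≤ s < n`. -/
def rlDerivLeft (s : ℝ) (w : ℝ → ℝ) : ℝ → ℝ :=
  iteratedDeriv (rlOrder s) (rlIntegralLeft ((rlOrder s : ℝ) - s) w)

/-- The right Riemann-Liouville derivative of order `s > 0` over the whole line: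
`(-1)^n (d/dx)^n` of the right integral of order `n - s`, with `n - 1 ≤ s < n`. -/
def rlDerivRight (s : ℝ) (w : ℝ → ℝ) (x : ℝ) : ℝ :=
  (-1) ^ rlOrder s * iteratedDeriv (rlOrder s) (rlIntegralRight ((rlOrder s : ℝ) - s) w) x

/-- Test functions: `C_0^∞(ℝ)`, real valued. -/
def IsTestFunction (ψ : ℝ → ℝ) : Prop :=
  ContDiff ℝ ∞ ψ ∧ HasCompactSupport ψ

/-- `w` is the weak `s`-order left fractional derivative of `v`. The pairing of `v` with the right
derivative of a test function has to exist as an absolutely convergent integral. -/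
def IsWeakFracDerivLeft (s : ℝ) (v w : ℝ → ℝ) : Prop :=
  LocallyIntegrable v ∧ LocallyIntegrable w ∧ ∀ ψ : ℝ → ℝ, IsTestFunction ψ →
    Integrable (fun x => v x * rlDerivRight s ψ x) ∧
      ∫ x, v x * rlDerivRight s ψ x = ∫ x, w x * ψ x

/-- `w` is the weak `s`-order right fractional derivative of `v`. -/
def IsWeakFracDerivRight (s : ℝ) (v w : ℝ → ℝ) : Prop :=
  LocallyIntegrable v ∧ LocallyIntegrable w ∧ ∀ ψ : ℝ → ℝ, IsTestFunction ψ →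
    Integrable (fun x => v x * rlDerivLeft s ψ x) ∧
      ∫ x, v x * rlDerivLeft s ψ x = ∫ x, w x * ψ x

/-- `w` is the (classical, first order) weak derivative of `v`. -/
def IsWeakDeriv (v w : ℝ → ℝ) : Prop :=
  LocallyIntegrable v ∧ LocallyIntegrable w ∧ ∀ ψ : ℝ → ℝ, IsTestFunction ψ →
    ∫ x, v x * deriv ψ x = - ∫ x, w x * ψ x

/-- The Plancherel transform of a real valued square integrable function on `ℝ`, for the
normalization `∫ e^{-2πixξ} w(x) dx`. -/
def plancherel {w : ℝ → ℝ} (hw : MemLp w 2 volume) : Lp ℂ 2 (volume : Measure ℝ) :=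
  𝓕 (hw.ofReal.toLp (fun x => (w x : ℂ)))

/-- `w` belongs to the Sobolev space of order `s ≥ 0`:
`w ∈ L²(ℝ)` and `∫ (1 + |2πξ|^(2s)) |ŵ(ξ)|² dξ < ∞`. -/
def MemHHat (s : ℝ) (w : ℝ → ℝ) : Prop :=
  ∃ hw : MemLp w 2 volume,
    Integrable (fun ξ : ℝ => (1 + |2 * Real.pi * ξ| ^ (2 * s)) * ‖plancherel hw ξ‖ ^ 2)

/-- `u` solves `p 𝐃^(2-μ) u + q 𝐃^((2-μ)*) u + a D u + b u = f` in the Sobolev space of order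
`2 - μ`: the derivatives are weak ones and the equation holds almost everywhere. -/
def IsSolution (p q a b μ : ℝ) (f u : ℝ → ℝ) : Prop :=
  MemHHat (2 - μ) u ∧ ∃ uL uR u' : ℝ → ℝ,
    IsWeakFracDerivLeft (2 - μ) u uL ∧ IsWeakFracDerivRight (2 - μ) u uR ∧ IsWeakDeriv u u' ∧
      ∀ᵐ x, p * uL x + q * uR x + a * u' x + b * u x = f x

/-- The exponents `σ_1, …, σ_5`. -/
def sigmaExp (μ : ℝ) : ℕ → ℝ
  | 1 => 2 - μ
  | 2 => (3 - μ) / 2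
  | 3 => 1
  | 4 => (2 - μ) / 2
  | _ => 0

/-- The constants `C_1, …, C_5`. -/
def coeffC (p q a b μ : ℝ) : ℕ → ℝ
  | 1 => p ^ 2 + q ^ 2 + 2 * p * q * Real.cos (sigmaExp μ 1 * Real.pi)
  | 2 => 2 * a * (q - p) * Real.cos (sigmaExp μ 2 * Real.pi)
  | 3 => a ^ 2
  | 4 => 2 * b * (p + q) * Real.cos (sigmaExp μ 4 * Real.pi)
  | 5 => b ^ 2
  | _ => 0

/-- The disjunction of the four cases under which the equation is solved; in the last three, the
two inequalities hold for a common `α > 0`. -/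
def CoeffCondition (p q a b μ : ℝ) : Prop :=
  let C := coeffC p q a b μ
  let σ := sigmaExp μ
  (0 ≤ C 2 ∧ 0 ≤ C 4) ∨
  (0 ≤ C 2 ∧ C 4 < 0 ∧ ∃ α : ℝ, 0 < α ∧ b ^ 2 > -(C 4 * α ^ (2 * (σ 5 - σ 4))) ∧
    0 < ∑ j ∈ Finset.Icc 1 4, C j / α ^ (2 * σ j - 1)) ∨
  (C 2 < 0 ∧ 0 ≤ C 4 ∧ ∃ α : ℝ, 0 < α ∧
    b ^ 2 > -∑ j ∈ Finset.Icc 2 4, C j * α ^ (2 * (σ 5 - σ j)) ∧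
    0 < ∑ j ∈ Finset.Icc 1 2, C j / α ^ (2 * σ j - 1)) ∨
  (C 2 < 0 ∧ C 4 < 0 ∧ ∃ α : ℝ, 0 < α ∧
    b ^ 2 > -∑ j ∈ ({2, 4} : Finset ℕ), C j * α ^ (2 * (σ 5 - σ j)) ∧
    0 < ∑ j ∈ ({1, 2, 4} : Finset ℕ), C j / α ^ (2 * σ j - 1))

end

/-!
The equation is solved on the Fourier side. A Riemann-Liouville derivative of a test function `ψ`
is the Fourier multiplier with symbol `(±2πiξ)^s` (`rlDerivLeft_eq_fourier`,
`rlDerivRight_eq_fourier`); this rests on `∫_0^∞ r^(σ-1) e^(-zr) dr = Γ(σ) z^(-σ)` for `Re z > 0`,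
which is carried to the imaginary axis by a limit. Hence `u` solves the equation exactly when
`P · û = f̂` almost everywhere, where
`P(ξ) = p (2πiξ)^s + q (-2πiξ)^s + a (2πiξ) + b` with `s = 2 - μ`
(`IsSolution.plancherel_eq`, `isSolution_of_plancherel_eq`).

With `w = |2πξ|` one has `|P(ξ)|² = C₁ w^(2σ₁) + ⋯ + C₅ w^(2σ₅)` (`norm_opSymbol_sq`). Here
`C₁ > 0` because `sin((2-μ)π) ≠ 0`, and each of the four conditions on the coefficients makes the
sum positive: with `t = α w`, the negative terms are absorbed by `b²` for `t ≤ 1`, and by the terms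
of higher order for `t ≥ 1` (`symbolNormSq_pos`). Since `|P|²` is continuous in `w` and comparable
to `w^(2s)` at infinity, `P` is elliptic:
`|P(ξ)| ≥ c (1 + |2πξ|^s)` (`exists_le_norm_opSymbol`). This gives existence, with
`û = f̂ / P`, and uniqueness. The solution is real because `P(-ξ)` is the conjugate of `P(ξ)`.

For the smoothness, `m = 1 / P` is singular at `ξ = 0`, but away from the origin it satisfies symbol
estimates `|m^(k)(ξ)| ≤ A_k |ξ|^(-k)` (`IsSymbol`). Let `φ` be a smooth cutoff that is `1` near
`0`, and `κ = φ · 𝓕⁻ m`. Taylor expansion of `m` under the convolution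
`𝓕 κ = m ∗ 𝓕 φ` shows that `m - 𝓕 κ` decays faster than any power
(`exists_norm_sub_fourier_mul_fourierInv_le`), so that `𝓕⁻ ((m - 𝓕 κ) f̂)` is smooth for
every `f ∈ L²`. The remaining part `𝓕⁻ (𝓕 κ · f̂)` is the convolution of `f` with the compactly
supported continuous function `κ`, which is smooth because `f` is. No decay of the derivatives of
`f` is needed, which is why the kernel is cut off rather than the equation differentiated.
-/

noncomputable section

/-! ### The Fourier transform on `L²` -/

/-- Multiplication formula `∫ 𝓕 f * g = ∫ f * 𝓕 g` for integrable functions. -/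
theorem integral_fourier_mul_flip {f g : ℝ → ℂ} (hf : Integrable f) (hg : Integrable g) :
    ∫ ξ, 𝓕 f ξ * g ξ = ∫ x, f x * 𝓕 g x := by
  have := VectorFourier.integral_fourierIntegral_smul_eq_flip (L := innerₗ ℝ)
    Real.continuous_fourierChar continuous_inner hf hg
  simpa only [flip_innerₗ, smul_eq_mul] using! this

/-- Multiplication formula `∫ 𝓕 u * v = ∫ u * 𝓕 v` on `L²`; it extends from Schwartz functions by
density. -/
theorem integral_Lp_fourier_mul_flip (u v : Lp ℂ 2 (volume : Measure ℝ)) :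
    ∫ ξ, (𝓕 u : Lp ℂ 2 (volume : Measure ℝ)) ξ * v ξ
      = ∫ x, u x * (𝓕 v : Lp ℂ 2 (volume : Measure ℝ)) x := by
  obtain ⟨B, hB⟩ : ∃ B : Lp ℂ 2 (volume : Measure ℝ) →L[ℂ] Lp ℂ 2 (volume : Measure ℝ) →L[ℂ] ℂ,
      ∀ a b, B a b = ∫ x, a x * b x :=
    ⟨(ContinuousLinearMap.mul ℂ ℂ).lpPairing (volume : Measure ℝ) 2 2, fun a b => by
      simp [ContinuousLinearMap.lpPairing_eq_integral]⟩
  rw [← hB, ← hB]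
  have hF : Continuous (fun w : Lp ℂ 2 (volume : Measure ℝ) => 𝓕 w) :=
    (Lp.fourierTransformₗᵢ ℝ ℂ).continuous
  refine DenseRange.induction_on₂ (e := SchwartzMap.toLpCLM ℂ ℂ 2 (volume : Measure ℝ))
    (p := fun a b => B (𝓕 a) b = B a (𝓕 b))
    (SchwartzMap.denseRange_toLpCLM ENNReal.ofNat_ne_top) ?_ ?_ u v
  · have hB' : Continuous (fun x : Lp ℂ 2 (volume : Measure ℝ) × Lp ℂ 2 (volume : Measure ℝ) =>
        B x.1 x.2) :=
      (B.continuous.comp continuous_fst).clm_apply continuous_snd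
    exact isClosed_eq (hB'.comp ((hF.comp continuous_fst).prodMk continuous_snd))
      (hB'.comp (continuous_fst.prodMk (hF.comp continuous_snd)))
  · intro f g
    simp only [SchwartzMap.toLpCLM_apply, SchwartzMap.toLp_fourier_eq]
    rw [hB, hB]
    calc _ = ∫ x, (𝓕 f) x * g x := integral_congr_ae <| by
            filter_upwards [(𝓕 f).coeFn_toLp 2 volume, g.coeFn_toLp 2 volume] with x h1 h2
            rw [h1, h2]
      _ = ∫ x, f x * (𝓕 g) x := SchwartzMap.integral_fourier_mul_eq f g
      _ = _ := integral_congr_ae <| by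
            filter_upwards [(𝓕 g).coeFn_toLp 2 volume, f.coeFn_toLp 2 volume] with x h1 h2
            rw [h1, h2]

/-- A real test function, regarded as a complex Schwartz function. -/
def IsTestFunction.schwartz {ψ : ℝ → ℝ} (hψ : IsTestFunction ψ) : SchwartzMap ℝ ℂ :=
  HasCompactSupport.toSchwartzMap (f := fun x => (ψ x : ℂ))
    (hψ.2.comp_left (g := Complex.ofReal) Complex.ofReal_zero)
    (Complex.ofRealCLM.contDiff.comp hψ.1)

theorem IsTestFunction.schwartz_apply {ψ : ℝ → ℝ} (hψ : IsTestFunction ψ) (x : ℝ) :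
    hψ.schwartz x = ψ x := rfl

/-- Two locally integrable functions with the same integrals against all test functions agree
almost everywhere. -/
theorem ae_eq_of_forall_test {f g : ℝ → ℂ} (hf : LocallyIntegrable f) (hg : LocallyIntegrable g)
    (h : ∀ ψ (hψ : IsTestFunction ψ), ∫ x, f x * hψ.schwartz x = ∫ x, g x * hψ.schwartz x) :
    f =ᵐ[volume] g := by
  refine ae_eq_of_integral_contDiff_smul_eq hf hg fun ψ h1 h2 => ?_
  have : ∫ x, f x * (ψ x : ℂ) = ∫ x, g x * (ψ x : ℂ) := h ψ ⟨h1, h2⟩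
  simpa only [Complex.real_smul, mul_comm] using this

theorem Lp.locallyIntegrable_coeFn (u : Lp ℂ 2 (volume : Measure ℝ)) : LocallyIntegrable u :=
  (Lp.memLp u).locallyIntegrable (by norm_num)

theorem continuous_fourier_of_integrable {g : ℝ → ℂ} (hg : Integrable g) : Continuous (𝓕 g) :=
  VectorFourier.fourierIntegral_continuous Real.continuous_fourierChar
    (innerSL ℝ).continuous₂ hg

theorem norm_fourier_le (g : ℝ → ℂ) (ξ : ℝ) : ‖𝓕 g ξ‖ ≤ ∫ x, ‖g x‖ :=
  VectorFourier.norm_fourierIntegral_le_integral_norm _ _ _ g ξ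

/-- On `L¹ ∩ L²` the Plancherel transform is given by the Fourier integral. -/
theorem Lp_fourier_toLp_ae_eq {g : ℝ → ℂ} (h1 : Integrable g) (h2 : MemLp g 2 volume) :
    (𝓕 (h2.toLp g) : Lp ℂ 2 (volume : Measure ℝ)) =ᵐ[volume] 𝓕 g := by
  refine ae_eq_of_forall_test (Lp.locallyIntegrable_coeFn _)
    (continuous_fourier_of_integrable h1).locallyIntegrable fun ψ hψ => ?_
  calc _ = ∫ x, (𝓕 (h2.toLp g) : Lp ℂ 2 (volume : Measure ℝ)) x * (hψ.schwartz.toLp 2) x :=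
        integral_congr_ae <| by
          filter_upwards [hψ.schwartz.coeFn_toLp 2 volume] with x hx
          rw [hx]
    _ = ∫ x, (h2.toLp g) x * (𝓕 (hψ.schwartz.toLp 2) : Lp ℂ 2 (volume : Measure ℝ)) x :=
        integral_Lp_fourier_mul_flip _ _
    _ = ∫ x, g x * 𝓕 (hψ.schwartz : ℝ → ℂ) x := integral_congr_ae <| by
          rw [SchwartzMap.toLp_fourier_eq]
          filter_upwards [(𝓕 hψ.schwartz).coeFn_toLp 2 volume, h2.coeFn_toLp] with x hx h'
          rw [hx, h', SchwartzMap.fourier_coe]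
    _ = _ := (integral_fourier_mul_flip h1 hψ.schwartz.integrable).symm

/-- Pairing an `L²` function with the Fourier integral of a function in `L¹ ∩ L²`. -/
theorem integral_mul_fourier (u : Lp ℂ 2 (volume : Measure ℝ)) {g : ℝ → ℂ} (h1 : Integrable g)
    (h2 : MemLp g 2 volume) :
    ∫ x, u x * 𝓕 g x = ∫ ξ, (𝓕 u : Lp ℂ 2 (volume : Measure ℝ)) ξ * g ξ := by
  calc _ = ∫ x, u x * (𝓕 (h2.toLp g) : Lp ℂ 2 (volume : Measure ℝ)) x := integral_congr_ae <| by
          filter_upwards [Lp_fourier_toLp_ae_eq h1 h2] with x hx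
          rw [hx]
    _ = ∫ x, (𝓕 u : Lp ℂ 2 (volume : Measure ℝ)) x * (h2.toLp g) x :=
          (integral_Lp_fourier_mul_flip _ _).symm
    _ = _ := integral_congr_ae <| by
          filter_upwards [h2.coeFn_toLp] with x hx
          rw [hx]

theorem memLp_fourier {g : ℝ → ℂ} (h1 : Integrable g) (h2 : MemLp g 2 volume) :
    MemLp (𝓕 g) 2 volume :=
  (memLp_congr_ae (Lp_fourier_toLp_ae_eq h1 h2)).1 (Lp.memLp _)

/-- The inverse Plancherel transform paired with a Schwartz function. -/
theorem integral_Lp_fourierInv_mul (w : Lp ℂ 2 (volume : Measure ℝ)) (ψ : SchwartzMap ℝ ℂ) :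
    ∫ x, (𝓕⁻ w : Lp ℂ 2 (volume : Measure ℝ)) x * ψ x = ∫ ξ, w ξ * (𝓕⁻ ψ) ξ := by
  have h := integral_mul_fourier (𝓕⁻ w) (𝓕⁻ ψ).integrable ((𝓕⁻ ψ).memLp 2 volume)
  rw [← SchwartzMap.fourier_coe, FourierTransform.fourier_fourierInv_eq,
    FourierTransform.fourier_fourierInv_eq] at h
  exact h

/-- Elements of `L²` are determined by the pairings of their transforms with `𝓕⁻ ψ`, `ψ` a test
function. -/
theorem Lp_eq_of_forall_test {v w : Lp ℂ 2 (volume : Measure ℝ)}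
    (h : ∀ ψ (hψ : IsTestFunction ψ),
      ∫ ξ, v ξ * (𝓕⁻ hψ.schwartz) ξ = ∫ ξ, w ξ * (𝓕⁻ hψ.schwartz) ξ) : v = w := by
  have : (𝓕⁻ v : Lp ℂ 2 (volume : Measure ℝ)) = 𝓕⁻ w := by
    refine Lp.ext (ae_eq_of_forall_test (Lp.locallyIntegrable_coeFn _)
      (Lp.locallyIntegrable_coeFn _) fun ψ hψ => ?_)
    rw [integral_Lp_fourierInv_mul, integral_Lp_fourierInv_mul, h]
  have := congrArg (fun z : Lp ℂ 2 (volume : Measure ℝ) => 𝓕 z) this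
  simpa [FourierTransform.fourier_fourierInv_eq] using this

/-! ### Riemann-Liouville integrals and derivatives of test functions on the Fourier side -/

open ProbabilityTheory Filter Topology in
/-- `∫₀^∞ r^(a-1) e^{-λr} dr = Γ(a) λ^{-a}` for complex `λ` with positive real part. The formula is
known for real `λ`; both sides are analytic in the half plane. -/
theorem integral_rpow_mul_cexp_neg_mul_Ioi {a : ℝ} (ha : 0 < a) {l : ℂ} (hl : 0 < l.re) :
    ∫ r in Set.Ioi (0 : ℝ), ((r ^ (a - 1) : ℝ) : ℂ) * Complex.exp (-(l * r))
      = Real.Gamma a * l ^ (-(a : ℂ)) := by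
  -- The left side is a moment generating function at `-λ`, for the measure `r^(a-1) dr`.
  set ν : Measure ℝ := (volume.restrict (Set.Ioi (0 : ℝ))).withDensity
    fun r => ENNReal.ofReal (r ^ (a - 1)) with hν
  have hmeas : Measurable fun r : ℝ => ENNReal.ofReal (r ^ (a - 1)) := by fun_prop
  have hfin : ∀ᵐ r ∂(volume.restrict (Set.Ioi (0 : ℝ))),
      ENNReal.ofReal (r ^ (a - 1)) < ⊤ := ae_of_all _ fun _ => ENNReal.ofReal_lt_top
  have hexp : Set.Iio 0 ⊆ integrableExpSet id ν := by
    intro t ht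
    have ht' : 0 < -t := by simpa using ht
    change Integrable (fun r : ℝ => Real.exp (t * r)) ν
    rw [hν, integrable_withDensity_iff_integrable_smul' hmeas hfin]
    have := integrableOn_rpow_mul_exp_neg_mul_rpow (p := 1) (s := a - 1) (by linarith) one_pos ht'
    refine Integrable.congr this ?_
    filter_upwards [ae_restrict_mem measurableSet_Ioi] with r hr
    rw [ENNReal.toReal_ofReal (Real.rpow_nonneg (le_of_lt hr) _), Real.rpow_one, neg_neg,
      smul_eq_mul]
  have hmgf : ∀ z : ℂ, complexMGF id ν z
      = ∫ r in Set.Ioi (0 : ℝ), ((r ^ (a - 1) : ℝ) : ℂ) * Complex.exp (z * r) := by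
    intro z
    rw [complexMGF, hν, integral_withDensity_eq_integral_toReal_smul hmeas hfin]
    refine setIntegral_congr_fun measurableSet_Ioi fun r hr => ?_
    dsimp only [id]
    rw [ENNReal.toReal_ofReal (Real.rpow_nonneg (le_of_lt hr) _), Complex.real_smul]
  have hA : AnalyticOnNhd ℂ (complexMGF id ν) {z | z.re < 0} :=
    (analyticOnNhd_complexMGF (X := id) (μ := ν)).mono fun z hz =>
      interior_maximal hexp isOpen_Iio hz
  have hop : IsOpen {z : ℂ | z.re < 0} := isOpen_Iio.preimage Complex.continuous_re
  have hB : AnalyticOnNhd ℂ (fun z : ℂ => (Real.Gamma a : ℂ) * (-z) ^ (-(a : ℂ)))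
      {z | z.re < 0} := by
    refine DifferentiableOn.analyticOnNhd (fun z hz => ?_) hop
    exact (((differentiableAt_id.neg).cpow_const
      (Or.inl (by simpa using hz))).const_mul _).differentiableWithinAt
  have hpre : IsPreconnected {z : ℂ | z.re < 0} :=
    (convex_halfSpace_re_lt 0).isPreconnected
  have hEq := hA.eqOn_of_preconnected_of_frequently_eq hB hpre (z₀ := ((-1 : ℝ) : ℂ)) (by simp) ?_
  · have := hEq (x := -l) (by simpa using hl)
    rw [hmgf] at this
    simpa using this
  · have ht : Tendsto (fun x : ℝ => (x : ℂ)) (𝓝[≠] (-1)) (𝓝[≠] ((-1 : ℝ) : ℂ)) :=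
      Complex.continuous_ofReal.continuousWithinAt.tendsto_nhdsWithin fun x hx => by
        simpa [← Complex.ofReal_neg, ← Complex.ofReal_one] using hx
    refine ht.frequently (Eventually.frequently ?_)
    have : ∀ᶠ x in 𝓝[≠] (-1 : ℝ), x < 0 := nhdsWithin_le_nhds (Iio_mem_nhds (by norm_num))
    filter_upwards [this] with x hx
    rw [hmgf]
    have h := Real.integral_rpow_mul_exp_neg_mul_Ioi ha (neg_pos.2 hx)
    have hx' : (0 : ℝ) ≤ -x := by linarith
    rw [one_div, Real.inv_rpow hx', ← Real.rpow_neg hx', mul_comm] at h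
    rw [← Complex.ofReal_neg, ← Complex.ofReal_neg, ← Complex.ofReal_cpow hx',
      ← Complex.ofReal_mul, ← h, ← integral_complex_ofReal]
    refine integral_congr_ae (ae_of_all _ fun r => ?_)
    push_cast
    simp

/-- The symbol `2πiξ` of the derivative. -/
def freq (ξ : ℝ) : ℂ := 2 * Real.pi * Complex.I * ξ

theorem norm_freq (ξ : ℝ) : ‖freq ξ‖ = 2 * Real.pi * |ξ| := by
  simp [freq, abs_of_pos Real.pi_pos]

theorem freq_re (ξ : ℝ) : (freq ξ).re = 0 := by simp [freq]

theorem freq_im (ξ : ℝ) : (freq ξ).im = 2 * Real.pi * ξ := by simp [freq]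

theorem freq_ne_zero {ξ : ℝ} (h : ξ ≠ 0) : freq ξ ≠ 0 := by
  simp [freq, h, Real.pi_ne_zero]

theorem continuous_freq : Continuous freq := by unfold freq; fun_prop

theorem measurable_freq : Measurable freq := continuous_freq.measurable

theorem locallyIntegrable_norm_rpow {r : ℝ} (hr : -1 < r) :
    LocallyIntegrable fun x : ℝ => |x| ^ r := by
  refine locallyIntegrable_of_norm_le_rpow (C := 1) (α := -r) (by simp) (by simp; linarith)
    (ae_of_all _ fun x => ?_) (Measurable.aestronglyMeasurable (by fun_prop))
  rw [neg_neg, one_mul, Real.norm_of_nonneg (by positivity), Real.norm_eq_abs]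

theorem integrable_norm_freq_rpow_mul {g : ℝ → ℂ} (hg : Integrable g) {C : ℝ}
    (hC : ∀ x, ‖g x‖ ≤ C) {r : ℝ} (hr : -1 < r) (hr' : r ≤ 0) :
    Integrable fun ξ => ‖freq ξ‖ ^ r * ‖g ξ‖ := by
  have hm : Measurable fun ξ => ‖freq ξ‖ ^ r := by
    have := measurable_freq
    fun_prop
  have hC0 : 0 ≤ C := (norm_nonneg _).trans (hC 0)
  have h1 : IntegrableOn (fun ξ : ℝ => (2 * Real.pi) ^ r * |ξ| ^ r * C) (Set.Icc (-1) 1) :=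
    (((locallyIntegrable_norm_rpow hr).integrableOn_isCompact isCompact_Icc).const_mul _).mul_const _
  have h1' := (integrable_indicator_iff measurableSet_Icc).2 h1
  refine Integrable.mono' (h1'.add hg.norm)
    (hm.aestronglyMeasurable.mul hg.1.norm) (ae_of_all _ fun ξ => ?_)
  rw [Real.norm_of_nonneg (by positivity)]
  have hpi : 1 ≤ 2 * Real.pi := by linarith [Real.pi_gt_three]
  by_cases h : ξ ∈ Set.Icc (-1 : ℝ) 1
  · simp only [Pi.add_apply, Set.indicator_of_mem h]
    rw [norm_freq, Real.mul_rpow (by positivity) (abs_nonneg _)]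
    have := mul_le_mul_of_nonneg_left (hC ξ)
      (show 0 ≤ (2 * Real.pi) ^ r * |ξ| ^ r by positivity)
    linarith [norm_nonneg (g ξ)]
  · simp only [Pi.add_apply, Set.indicator_of_notMem h, zero_add]
    have hx : 1 ≤ |ξ| := by
      by_contra! h'
      exact h ⟨by linarith [(abs_lt.1 h').1], (abs_lt.1 h').2.le⟩
    refine mul_le_of_le_one_left (norm_nonneg _) (Real.rpow_le_one_of_one_le_of_nonpos ?_ hr')
    rw [norm_freq]
    nlinarith

theorem SchwartzMap.exists_norm_le (θ : SchwartzMap ℝ ℂ) : ∃ C, ∀ x, ‖θ x‖ ≤ C := by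
  obtain ⟨C, -, hC⟩ := θ.decay 0 0
  exact ⟨C, fun x => by simpa using hC x⟩

theorem fourier_eq_integral_freq (g : ℝ → ℂ) (x : ℝ) :
    𝓕 g x = ∫ ξ, Complex.exp (-(freq ξ * x)) * g ξ := by
  rw [Real.fourier_real_eq_integral_exp_smul]
  refine integral_congr_ae (ae_of_all _ fun ξ => ?_)
  simp only [smul_eq_mul, freq]
  congr 2
  push_cast
  ring

theorem norm_exp_neg_freq_mul (ξ x : ℝ) : ‖Complex.exp (-(freq ξ * x))‖ = 1 := by
  rw [Complex.norm_exp]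
  simp [freq]

/-- The half line integral of a Fourier transform against `r^(μ-1) e^{-εr}`. -/
theorem integral_rpow_mul_exp_mul_fourier {μ : ℝ} (hμ : 0 < μ) (τ : ℝ) (θ : SchwartzMap ℝ ℂ)
    (x : ℝ) {ε : ℝ} (hε : 0 < ε) :
    ∫ r in Set.Ioi (0 : ℝ), ((r ^ (μ - 1) * Real.exp (-(ε * r)) : ℝ) : ℂ) *
        𝓕 (θ : ℝ → ℂ) (x + τ * r)
      = ∫ ξ, Complex.exp (-(freq ξ * x)) * θ ξ *
          (Real.Gamma μ * (ε + τ * freq ξ) ^ (-(μ : ℂ))) := by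
  have hI : IntegrableOn (fun r : ℝ => r ^ (μ - 1) * Real.exp (-(ε * r))) (Set.Ioi 0) := by
    have := integrableOn_rpow_mul_exp_neg_mul_rpow (p := 1) (s := μ - 1) (by linarith) one_pos hε
    simpa using this
  have hprod : Integrable (Function.uncurry fun r ξ : ℝ =>
      ((r ^ (μ - 1) * Real.exp (-(ε * r)) : ℝ) : ℂ) *
        (Complex.exp (-(freq ξ * (x + τ * r : ℝ))) * θ ξ))
      ((volume.restrict (Set.Ioi (0 : ℝ))).prod volume) := by
    have h1 := (Integrable.ofReal (𝕜 := ℂ) hI).mul_prod (θ.integrable (μ := volume))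
    have hc := continuous_freq
    have h2 : Continuous fun z : ℝ × ℝ => Complex.exp (-(freq z.2 * (x + τ * z.1 : ℝ))) := by
      fun_prop
    refine (h1.bdd_mul (c := 1) h2.aestronglyMeasurable
      (ae_of_all _ fun z => (norm_exp_neg_freq_mul _ _).le)).congr (ae_of_all _ fun z => ?_)
    simp only [Function.uncurry, RCLike.ofReal_eq_complex_ofReal]
    ring
  calc _ = ∫ r in Set.Ioi (0 : ℝ), ∫ ξ, ((r ^ (μ - 1) * Real.exp (-(ε * r)) : ℝ) : ℂ) *
        (Complex.exp (-(freq ξ * (x + τ * r : ℝ))) * θ ξ) := by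
        refine integral_congr_ae (ae_of_all _ fun r => ?_)
        dsimp only
        rw [fourier_eq_integral_freq, integral_const_mul]
    _ = ∫ ξ, ∫ r in Set.Ioi (0 : ℝ), ((r ^ (μ - 1) * Real.exp (-(ε * r)) : ℝ) : ℂ) *
        (Complex.exp (-(freq ξ * (x + τ * r : ℝ))) * θ ξ) := integral_integral_swap hprod
    _ = _ := by
        refine integral_congr_ae (ae_of_all _ fun ξ => ?_)
        dsimp only
        rw [← integral_rpow_mul_cexp_neg_mul_Ioi hμ (l := ε + τ * freq ξ)
          (by simpa [freq] using hε), ← integral_const_mul]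
        refine integral_congr_ae (ae_of_all _ fun r => ?_)
        dsimp only
        rw [show -((ε + τ * freq ξ) * r) = -((ε : ℂ) * r) + -(freq ξ * (τ * r : ℂ)) by ring,
          Complex.exp_add]
        rw [show -(freq ξ * ((x + τ * r : ℝ) : ℂ)) = -(freq ξ * x) + -(freq ξ * (τ * r : ℂ)) by
          push_cast; ring, Complex.exp_add]
        push_cast
        ring

open Filter Topology in
/-- The Riemann-Liouville integral of order `μ` acts as the multiplier `(±2πiξ)^(-μ)`; this is the
limit `ε → 0` of `integral_rpow_mul_exp_mul_fourier`. -/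
theorem integral_rpow_mul_fourier {μ : ℝ} (hμ : 0 < μ) (hμ' : μ < 1) {τ : ℝ} (hτ : |τ| = 1)
    (θ : SchwartzMap ℝ ℂ) (hθ : HasCompactSupport (𝓕 (θ : ℝ → ℂ))) (x : ℝ) :
    ∫ r in Set.Ioi (0 : ℝ), ((r ^ (μ - 1) : ℝ) : ℂ) * 𝓕 (θ : ℝ → ℂ) (x + τ * r)
      = Real.Gamma μ * 𝓕 (fun ξ => (τ * freq ξ) ^ (-(μ : ℂ)) * θ ξ) x := by
  have hτ0 : τ ≠ 0 := by rintro rfl; simp at hτ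
  have hcont : Continuous (𝓕 (θ : ℝ → ℂ)) := continuous_fourier_of_integrable θ.integrable
  have hL : Tendsto (fun ε : ℝ => ∫ r in Set.Ioi (0 : ℝ),
      ((r ^ (μ - 1) * Real.exp (-(ε * r)) : ℝ) : ℂ) * 𝓕 (θ : ℝ → ℂ) (x + τ * r)) (𝓝[>] 0)
      (𝓝 (∫ r in Set.Ioi (0 : ℝ), ((r ^ (μ - 1) : ℝ) : ℂ) * 𝓕 (θ : ℝ → ℂ) (x + τ * r))) := by
    refine tendsto_integral_filter_of_dominated_convergence
      (fun r => |r| ^ (μ - 1) * ‖𝓕 (θ : ℝ → ℂ) (x + τ * r)‖) ?_ ?_ ?_ ?_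
    · refine Eventually.of_forall fun ε => Measurable.aestronglyMeasurable ?_
      have := hcont.measurable
      fun_prop
    · filter_upwards [self_mem_nhdsWithin] with ε hε
      filter_upwards [ae_restrict_mem measurableSet_Ioi] with r hr
      have hr0 : 0 < r := hr
      have hε0 : 0 < ε := hε
      rw [norm_mul, Complex.norm_real, Real.norm_of_nonneg (by positivity), abs_of_pos hr0]
      refine mul_le_mul_of_nonneg_right ?_ (norm_nonneg _)
      refine mul_le_of_le_one_right (by positivity) (Real.exp_le_one_iff.2 ?_)
      have := mul_pos hε0 hr0
      linarith
    · have hc : HasCompactSupport fun r => ‖𝓕 (θ : ℝ → ℂ) (x + τ * r)‖ := by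
        have h1 := hθ.comp_homeomorph ((Homeomorph.mulLeft₀ τ hτ0).trans (Homeomorph.addLeft x))
        exact h1.norm
      have hl := locallyIntegrable_norm_rpow (r := μ - 1) (by linarith)
      have := hl.integrable_smul_right_of_hasCompactSupport
        (g := fun r => ‖𝓕 (θ : ℝ → ℂ) (x + τ * r)‖) (by fun_prop) hc
      exact this.integrableOn
    · refine ae_of_all _ fun r => ?_
      have : Continuous fun ε : ℝ =>
        ((r ^ (μ - 1) * Real.exp (-(ε * r)) : ℝ) : ℂ) * 𝓕 (θ : ℝ → ℂ) (x + τ * r) := by fun_prop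
      have := (this.tendsto 0).mono_left (nhdsWithin_le_nhds (s := Set.Ioi 0))
      simpa using this
  have hR : Tendsto (fun ε : ℝ => ∫ ξ, Complex.exp (-(freq ξ * x)) * θ ξ *
          (Real.Gamma μ * (ε + τ * freq ξ) ^ (-(μ : ℂ)))) (𝓝[>] 0)
      (𝓝 (∫ ξ, Complex.exp (-(freq ξ * x)) * θ ξ *
          (Real.Gamma μ * (τ * freq ξ) ^ (-(μ : ℂ))))) := by
    obtain ⟨C, hC⟩ := θ.exists_norm_le
    have hG : 0 < Real.Gamma μ := Real.Gamma_pos_of_pos hμ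
    refine tendsto_integral_filter_of_dominated_convergence
      (fun ξ => Real.Gamma μ * (‖freq ξ‖ ^ (-μ) * ‖θ ξ‖)) ?_ ?_ ?_ ?_
    · refine Eventually.of_forall fun ε => Measurable.aestronglyMeasurable ?_
      have := θ.continuous.measurable
      have := measurable_freq
      fun_prop
    · filter_upwards [self_mem_nhdsWithin] with ε hε
      filter_upwards [Measure.ae_ne volume (0 : ℝ)] with ξ hξ
      rw [norm_mul, norm_mul, norm_exp_neg_freq_mul, one_mul, norm_mul, Complex.norm_real,
        Real.norm_of_nonneg hG.le, ← Complex.ofReal_neg, Complex.norm_cpow_real]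
      -- `τ * freq ξ` is imaginary, so adding `ε` increases the modulus.
      have h1 : ‖freq ξ‖ ≤ ‖(ε : ℂ) + τ * freq ξ‖ := by
        have h2 := Complex.abs_im_le_norm ((ε : ℂ) + τ * freq ξ)
        have h3 : |((ε : ℂ) + τ * freq ξ).im| = ‖freq ξ‖ := by
          rw [norm_freq]
          simp [freq_im, freq_re, abs_mul, hτ, abs_of_pos Real.pi_pos]
        rwa [h3] at h2
      have h4 := Real.rpow_le_rpow_of_nonpos (norm_pos_iff.2 (freq_ne_zero hξ)) h1
        (show -μ ≤ 0 by linarith)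
      calc _ = Real.Gamma μ * (‖(ε : ℂ) + τ * freq ξ‖ ^ (-μ) * ‖θ ξ‖) := by ring
        _ ≤ _ := by gcongr
    · exact (integrable_norm_freq_rpow_mul θ.integrable hC (by linarith) (by linarith)).const_mul _
    · filter_upwards [Measure.ae_ne volume (0 : ℝ)] with ξ hξ
      have hs : (τ : ℂ) * freq ξ ∈ Complex.slitPlane := by
        refine Or.inr ?_
        simp [freq_im, freq_re, hτ0, hξ, Real.pi_ne_zero]
      have h1 : Tendsto (fun ε : ℝ => (ε : ℂ) + τ * freq ξ) (𝓝[>] 0) (𝓝 (τ * freq ξ)) := by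
        have : Continuous fun ε : ℝ => (ε : ℂ) + τ * freq ξ := by fun_prop
        have := (this.tendsto 0).mono_left (nhdsWithin_le_nhds (s := Set.Ioi 0))
        simpa using this
      exact (((continuousAt_cpow_const hs).tendsto.comp h1).const_mul _).const_mul _
  have hE : (fun ε : ℝ => ∫ ξ, Complex.exp (-(freq ξ * x)) * θ ξ *
          (Real.Gamma μ * (ε + τ * freq ξ) ^ (-(μ : ℂ)))) =ᶠ[𝓝[>] 0]
      (fun ε : ℝ => ∫ r in Set.Ioi (0 : ℝ),
      ((r ^ (μ - 1) * Real.exp (-(ε * r)) : ℝ) : ℂ) * 𝓕 (θ : ℝ → ℂ) (x + τ * r)) := by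
    filter_upwards [self_mem_nhdsWithin] with ε hε
    exact (integral_rpow_mul_exp_mul_fourier hμ τ θ x hε).symm
  rw [tendsto_nhds_unique hL (hR.congr' hE), fourier_eq_integral_freq, ← integral_const_mul]
  refine integral_congr_ae (ae_of_all _ fun ξ => ?_)
  dsimp only
  ring

theorem iteratedDeriv_ofReal {f : ℝ → ℝ} {n : ℕ} (hf : ContDiff ℝ n f) (x : ℝ) :
    iteratedDeriv n (fun y => (f y : ℂ)) x = ((iteratedDeriv n f x : ℝ) : ℂ) := by
  have := Complex.ofRealCLM.iteratedFDeriv_comp_left (x := x) hf.contDiffAt le_rfl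
  simp only [iteratedDeriv_eq_iteratedFDeriv]
  simpa [Function.comp_def] using! congrArg (fun L => L fun _ => (1 : ℝ)) this

theorem rlOrder_two_sub {μ : ℝ} (hμ : μ ∈ Set.Ioo (0 : ℝ) 1) : rlOrder (2 - μ) = 2 := by
  have : ⌊2 - μ⌋₊ = 1 := by
    rw [Nat.floor_eq_iff (by linarith [hμ.2])]
    constructor <;> norm_num <;> linarith [hμ.1, hμ.2]
  simp [rlOrder, this]

theorem pow_mul_cpow_neg {μ : ℝ} (hμ : μ ∈ Set.Ioo (0 : ℝ) 1) (z : ℂ) :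
    z ^ 2 * z ^ (-(μ : ℂ)) = z ^ ((2 - μ : ℝ) : ℂ) := by
  rcases eq_or_ne z 0 with rfl | hz
  · have : ((2 - μ : ℝ) : ℂ) ≠ 0 := by
      rw [Complex.ofReal_ne_zero]
      linarith [hμ.2]
    rw [Complex.zero_cpow this]
    simp
  · rw [← Complex.cpow_ofNat z 2, ← Complex.cpow_add _ _ hz]
    push_cast
    rfl

/-- Differentiating twice turns the multiplier `(±2πiξ)^(-μ)` into `(±2πiξ)^(2-μ)`. -/
theorem iteratedDeriv_two_eq_fourier {μ : ℝ} (hμ : μ ∈ Set.Ioo (0 : ℝ) 1) {τ : ℝ} (hτ : |τ| = 1)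
    (θ : SchwartzMap ℝ ℂ) {J : ℝ → ℝ}
    (hJ : ∀ x, (J x : ℂ) = 𝓕 (fun ξ => (τ * freq ξ) ^ (-(μ : ℂ)) * θ ξ) x) (x : ℝ) :
    ((iteratedDeriv 2 J x : ℝ) : ℂ) = 𝓕 (fun ξ => (τ * freq ξ) ^ ((2 - μ : ℝ) : ℂ) * θ ξ) x := by
  set g : ℝ → ℂ := fun ξ => (τ * freq ξ) ^ (-(μ : ℂ)) * θ ξ with hg
  have hgm : Measurable g := by
    have := measurable_freq
    have := θ.continuous.measurable
    fun_prop
  have hint : ∀ n : ℕ, Integrable fun ξ : ℝ => ξ ^ n • g ξ := by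
    intro n
    have h1 : Integrable fun ξ : ℝ => (ξ ^ n : ℝ) • θ ξ := by
      refine (θ.integrable_pow_mul volume n).mono' ?_ (ae_of_all _ fun ξ => ?_)
      · exact ((continuous_pow n).smul θ.continuous).aestronglyMeasurable
      · rw [norm_smul, norm_pow]
    obtain ⟨C, -, hC⟩ := θ.decay n 0
    have h2 := integrable_norm_freq_rpow_mul h1 (C := C)
      (fun ξ => by simpa [norm_smul] using hC ξ) (r := -μ) (by linarith [hμ.2]) (by linarith [hμ.1])
    refine h2.mono' (by fun_prop) (ae_of_all _ fun ξ => le_of_eq ?_)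
    simp only [hg]
    rw [norm_smul, norm_mul, norm_smul, ← Complex.ofReal_neg, Complex.norm_cpow_real, norm_mul,
      Complex.norm_real, Real.norm_eq_abs τ, hτ, one_mul]
    ring
  have hsm : ContDiff ℝ 2 (𝓕 g) := by
    refine Real.contDiff_fourier (N := 2) fun n _ => ?_
    simpa [norm_smul] using (hint n).norm
  have hJ' : J = fun x => (𝓕 g x).re := by
    ext y
    rw [← hJ]
    simp
  have hJs : ContDiff ℝ 2 J := by
    rw [hJ']
    exact Complex.reCLM.contDiff.comp hsm
  have hfun : (fun y => (J y : ℂ)) = 𝓕 g := funext hJ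
  rw [← iteratedDeriv_ofReal hJs, hfun,
    Real.iteratedDeriv_fourier (N := 2) (fun n _ => hint n) (by norm_num)]
  refine congrFun (congrArg _ (funext fun ξ => ?_)) x
  have hτ2 : (τ : ℂ) ^ 2 = 1 := by
    rw [← Complex.ofReal_pow, ← sq_abs, hτ]
    simp
  rw [← pow_mul_cpow_neg hμ, hg, smul_eq_mul]
  have : (-2 * (Real.pi : ℂ) * Complex.I * ξ) ^ 2 = (τ * freq ξ) ^ 2 := by
    rw [mul_pow (τ : ℂ), hτ2]
    simp only [freq]
    ring
  simp only [this]
  ring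

theorem IsTestFunction.fourier_fourierInv {ψ : ℝ → ℝ} (hψ : IsTestFunction ψ) :
    𝓕 ((𝓕⁻ hψ.schwartz : SchwartzMap ℝ ℂ) : ℝ → ℂ) = fun x => (ψ x : ℂ) := by
  rw [← SchwartzMap.fourier_coe, FourierTransform.fourier_fourierInv_eq]
  rfl

theorem rlIntegralRight_eq_fourier {μ : ℝ} (hμ : μ ∈ Set.Ioo (0 : ℝ) 1) {ψ : ℝ → ℝ}
    (hψ : IsTestFunction ψ) (x : ℝ) :
    (rlIntegralRight μ ψ x : ℂ)
      = 𝓕 (fun ξ => ((1 : ℝ) * freq ξ) ^ (-(μ : ℂ)) * (𝓕⁻ hψ.schwartz) ξ) x := by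
  have hc : HasCompactSupport (𝓕 ((𝓕⁻ hψ.schwartz : SchwartzMap ℝ ℂ) : ℝ → ℂ)) := by
    rw [hψ.fourier_fourierInv]
    exact hψ.2.comp_left (g := Complex.ofReal) Complex.ofReal_zero
  have h := integral_rpow_mul_fourier hμ.1 hμ.2 (τ := 1) (by simp) _ hc x
  have hG : (Real.Gamma μ : ℂ) ≠ 0 := by
    exact_mod_cast (Real.Gamma_pos_of_pos hμ.1).ne'
  rw [rlIntegralRight, Complex.ofReal_mul, Complex.ofReal_inv, inv_mul_eq_iff_eq_mul₀ hG, ← h,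
    hψ.fourier_fourierInv, integral_Ici_eq_integral_Ioi, ← integral_complex_ofReal]
  have := (measurePreserving_add_left volume x).setIntegral_preimage_emb
    (measurableEmbedding_addLeft x) (fun t => (((t - x) ^ (μ - 1) * ψ t : ℝ) : ℂ)) (Set.Ioi x)
  rw [← this]
  simp

theorem rlIntegralLeft_eq_fourier {μ : ℝ} (hμ : μ ∈ Set.Ioo (0 : ℝ) 1) {ψ : ℝ → ℝ}
    (hψ : IsTestFunction ψ) (x : ℝ) :
    (rlIntegralLeft μ ψ x : ℂ)
      = 𝓕 (fun ξ => ((-1 : ℝ) * freq ξ) ^ (-(μ : ℂ)) * (𝓕⁻ hψ.schwartz) ξ) x := by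
  have hc : HasCompactSupport (𝓕 ((𝓕⁻ hψ.schwartz : SchwartzMap ℝ ℂ) : ℝ → ℂ)) := by
    rw [hψ.fourier_fourierInv]
    exact hψ.2.comp_left (g := Complex.ofReal) Complex.ofReal_zero
  have h := integral_rpow_mul_fourier hμ.1 hμ.2 (τ := -1) (by simp) _ hc x
  have hG : (Real.Gamma μ : ℂ) ≠ 0 := by
    exact_mod_cast (Real.Gamma_pos_of_pos hμ.1).ne'
  rw [rlIntegralLeft, Complex.ofReal_mul, Complex.ofReal_inv, inv_mul_eq_iff_eq_mul₀ hG, ← h,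
    hψ.fourier_fourierInv, integral_Iic_eq_integral_Iio, ← integral_complex_ofReal]
  have := (Measure.measurePreserving_sub_left volume x).setIntegral_preimage_emb
    (Homeomorph.subLeft x).measurableEmbedding
    (fun t => (((x - t) ^ (μ - 1) * ψ t : ℝ) : ℂ)) (Set.Iio x)
  have hpre : (fun t => x - t) ⁻¹' Set.Iio x = Set.Ioi 0 := by
    ext t
    simp
  rw [← this, hpre]
  simp [sub_eq_add_neg]

/-- On test functions the right derivative of order `2 - μ` is the multiplier `(2πiξ)^(2-μ)` acting
on the inverse Fourier transform. -/
theorem rlDerivRight_eq_fourier {μ : ℝ} (hμ : μ ∈ Set.Ioo (0 : ℝ) 1) {ψ : ℝ → ℝ}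
    (hψ : IsTestFunction ψ) (x : ℝ) :
    (rlDerivRight (2 - μ) ψ x : ℂ)
      = 𝓕 (fun ξ => freq ξ ^ ((2 - μ : ℝ) : ℂ) * (𝓕⁻ hψ.schwartz) ξ) x := by
  have := iteratedDeriv_two_eq_fourier hμ (by simp) _ (rlIntegralRight_eq_fourier hμ hψ) x
  simp only [rlDerivRight, rlOrder_two_sub hμ]
  simpa using this

/-- On test functions the left derivative of order `2 - μ` is the multiplier `(-2πiξ)^(2-μ)` acting
on the inverse Fourier transform. -/
theorem rlDerivLeft_eq_fourier {μ : ℝ} (hμ : μ ∈ Set.Ioo (0 : ℝ) 1) {ψ : ℝ → ℝ}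
    (hψ : IsTestFunction ψ) (x : ℝ) :
    (rlDerivLeft (2 - μ) ψ x : ℂ)
      = 𝓕 (fun ξ => (-freq ξ) ^ ((2 - μ : ℝ) : ℂ) * (𝓕⁻ hψ.schwartz) ξ) x := by
  have := iteratedDeriv_two_eq_fourier hμ (by simp) _ (rlIntegralLeft_eq_fourier hμ hψ) x
  simp only [rlDerivLeft, rlOrder_two_sub hμ]
  simpa using this

theorem deriv_eq_fourier {ψ : ℝ → ℝ} (hψ : IsTestFunction ψ) (x : ℝ) :
    ((deriv ψ x : ℝ) : ℂ) = 𝓕 (fun ξ => -freq ξ * (𝓕⁻ hψ.schwartz) ξ) x := by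
  set θ := 𝓕⁻ hψ.schwartz with hθ
  have h1 : Integrable fun ξ : ℝ => ξ • θ ξ := by
    refine (θ.integrable_pow_mul volume 1).mono' ?_ (ae_of_all _ fun ξ => ?_)
    · exact (continuous_id.smul θ.continuous).aestronglyMeasurable
    · rw [norm_smul, pow_one]
  have h2 := Real.hasDerivAt_fourier θ.integrable h1 x
  rw [hψ.fourier_fourierInv] at h2
  have h3 : HasDerivAt ψ (deriv ψ x) x :=
    ((hψ.1.differentiable (by simp)) x).hasDerivAt
  rw [h3.ofReal_comp.unique h2]
  refine congrFun (congrArg _ (funext fun ξ => ?_)) x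
  simp only [freq, smul_eq_mul]
  ring

/-! ### The equation on the Fourier side -/

theorem MeasureTheory.Integrable.memLp_two_of_bound {g : ℝ → ℂ} (hg : Integrable g) {C : ℝ}
    (hC : ∀ x, ‖g x‖ ≤ C) : MemLp g 2 volume := by
  rw [memLp_two_iff_integrable_sq_norm hg.1]
  refine (hg.norm.const_mul C).mono' (hg.1.norm.pow 2) (ae_of_all _ fun x => ?_)
  rw [Real.norm_of_nonneg (by positivity), sq]
  exact mul_le_mul_of_nonneg_right (hC x) (norm_nonneg _)

theorem rpow_le_one_add_rpow {x r t : ℝ} (hx : 0 ≤ x) (hr : 0 ≤ r) (hrt : r ≤ t) :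
    x ^ r ≤ 1 + x ^ t := by
  rcases le_total x 1 with h | h
  · have := Real.rpow_le_one hx h hr
    have := Real.rpow_nonneg hx t
    linarith
  · have := Real.rpow_le_rpow_of_exponent_le h hrt
    linarith

theorem norm_symbol_mul_le (θ : SchwartzMap ℝ ℂ) {Λ : ℝ → ℂ} {k : ℝ} (hk : 0 ≤ k) (hk2 : k ≤ 2)
    (hb : ∀ ξ, ‖Λ ξ‖ = ‖freq ξ‖ ^ k) (ξ : ℝ) :
    ‖Λ ξ * θ ξ‖ ≤ ‖θ ξ‖ + (2 * Real.pi) ^ 2 * (‖ξ‖ ^ 2 * ‖θ ξ‖) := by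
  have := rpow_le_one_add_rpow (norm_nonneg (freq ξ)) hk hk2
  rw [Real.rpow_two] at this
  rw [norm_mul, hb]
  calc _ ≤ (1 + ‖freq ξ‖ ^ 2) * ‖θ ξ‖ := by gcongr
    _ = _ := by
      rw [norm_freq, Real.norm_eq_abs]
      ring

theorem integrable_symbol_mul (θ : SchwartzMap ℝ ℂ) {Λ : ℝ → ℂ} (hm : Measurable Λ) {k : ℝ}
    (hk : 0 ≤ k) (hk2 : k ≤ 2) (hb : ∀ ξ, ‖Λ ξ‖ = ‖freq ξ‖ ^ k) :
    Integrable fun ξ => Λ ξ * θ ξ :=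
  (θ.integrable.norm.add ((θ.integrable_pow_mul volume 2).const_mul ((2 * Real.pi) ^ 2))).mono'
    (hm.aestronglyMeasurable.mul θ.continuous.aestronglyMeasurable)
    (ae_of_all _ fun ξ => norm_symbol_mul_le θ hk hk2 hb ξ)

theorem memLp_symbol_mul (θ : SchwartzMap ℝ ℂ) {Λ : ℝ → ℂ} (hm : Measurable Λ) {k : ℝ}
    (hk : 0 ≤ k) (hk2 : k ≤ 2) (hb : ∀ ξ, ‖Λ ξ‖ = ‖freq ξ‖ ^ k) :
    MemLp (fun ξ => Λ ξ * θ ξ) 2 volume := by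
  obtain ⟨C0, -, h0⟩ := θ.decay 0 0
  obtain ⟨C2, -, h2⟩ := θ.decay 2 0
  refine (integrable_symbol_mul θ hm hk hk2 hb).memLp_two_of_bound
    (C := C0 + (2 * Real.pi) ^ 2 * C2) fun ξ => (norm_symbol_mul_le θ hk hk2 hb ξ).trans ?_
  have h0' : ‖θ ξ‖ ≤ C0 := by simpa using h0 ξ
  have h2' : ‖ξ‖ ^ 2 * ‖θ ξ‖ ≤ C2 := by simpa using h2 ξ
  gcongr

/-- Pairing a real `L²` function with a function that arises from a test function by the
multiplier `Λ` on the inverse transform. -/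
theorem integrable_and_integral_mul_multiplier {v : ℝ → ℝ} (hv : MemLp v 2 volume) {ψ : ℝ → ℝ}
    (hψ : IsTestFunction ψ) {Λ : ℝ → ℂ} (hm : Measurable Λ) {k : ℝ}
    (hk : 0 ≤ k) (hk2 : k ≤ 2) (hb : ∀ ξ, ‖Λ ξ‖ = ‖freq ξ‖ ^ k) {d : ℝ → ℝ}
    (hd : ∀ x, (d x : ℂ) = 𝓕 (fun ξ => Λ ξ * (𝓕⁻ hψ.schwartz) ξ) x) :
    Integrable (fun x => v x * d x) ∧
      ((∫ x, v x * d x : ℝ) : ℂ) = ∫ ξ, plancherel hv ξ * (Λ ξ * (𝓕⁻ hψ.schwartz) ξ) := by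
  have h1 := integrable_symbol_mul (𝓕⁻ hψ.schwartz) hm hk hk2 hb
  have h2 := memLp_symbol_mul (𝓕⁻ hψ.schwartz) hm hk hk2 hb
  constructor
  · have hdm : MemLp d 2 volume := by
      have := (memLp_fourier h1 h2).re
      refine (memLp_congr_ae (ae_of_all _ fun x => ?_)).1 this
      rw [← hd]
      simp
    exact hv.integrable_mul hdm
  · rw [← integral_complex_ofReal, plancherel, ← integral_mul_fourier _ h1 h2]
    refine integral_congr_ae ?_
    have hcoe : (hv.ofReal.toLp (fun x => (v x : ℂ)) : ℝ → ℂ) =ᵐ[volume] fun x => (v x : ℂ) :=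
      MemLp.coeFn_toLp _
    filter_upwards [hcoe] with x hx
    rw [← hd, hx]
    simp

theorem norm_freq_cpow (s ξ : ℝ) : ‖freq ξ ^ (s : ℂ)‖ = ‖freq ξ‖ ^ s :=
  Complex.norm_cpow_real _ _

theorem norm_neg_freq_cpow (s ξ : ℝ) : ‖(-freq ξ) ^ (s : ℂ)‖ = ‖freq ξ‖ ^ s := by
  rw [Complex.norm_cpow_real, norm_neg]

theorem measurable_freq_cpow (s : ℝ) : Measurable fun ξ => freq ξ ^ (s : ℂ) := by
  have := measurable_freq
  fun_prop

theorem measurable_neg_freq_cpow (s : ℝ) : Measurable fun ξ => (-freq ξ) ^ (s : ℂ) := by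
  have := measurable_freq
  fun_prop

theorem norm_two_pi_mul (ξ : ℝ) : |2 * Real.pi * ξ| = ‖freq ξ‖ := by
  rw [norm_freq, abs_mul, abs_of_pos (by positivity)]

/-- A multiplier of order `s` maps the transform of an element of the Sobolev space of order `s`
into `L²`. -/
theorem memLp_mul_plancherel {s : ℝ} {w : ℝ → ℝ} (hw : MemLp w 2 volume)
    (hI : Integrable (fun ξ : ℝ => (1 + |2 * Real.pi * ξ| ^ (2 * s)) * ‖plancherel hw ξ‖ ^ 2))
    {Λ : ℝ → ℂ} (hm : Measurable Λ) {C : ℝ}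
    (hb : ∀ ξ, ‖Λ ξ‖ ≤ C * (1 + ‖freq ξ‖ ^ s)) :
    MemLp (fun ξ => Λ ξ * plancherel hw ξ) 2 volume := by
  have hae : AEStronglyMeasurable (fun ξ => Λ ξ * plancherel hw ξ) volume :=
    hm.aestronglyMeasurable.mul (Lp.aestronglyMeasurable _)
  rw [memLp_two_iff_integrable_sq_norm hae]
  refine (hI.const_mul (2 * C ^ 2)).mono' (hae.norm.pow 2) (ae_of_all _ fun ξ => ?_)
  rw [Real.norm_of_nonneg (by positivity), norm_mul, mul_pow, ← mul_assoc, norm_two_pi_mul]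
  refine mul_le_mul_of_nonneg_right ?_ (by positivity)
  have h0 := Real.rpow_nonneg (norm_nonneg (freq ξ)) s
  calc ‖Λ ξ‖ ^ 2 ≤ (C * (1 + ‖freq ξ‖ ^ s)) ^ 2 := by gcongr; exact hb ξ
    _ = C ^ 2 * (1 + ‖freq ξ‖ ^ s) ^ 2 := by ring
    _ ≤ C ^ 2 * (2 * (1 + (‖freq ξ‖ ^ s) ^ 2)) := by
        gcongr
        nlinarith [sq_nonneg (1 - ‖freq ξ‖ ^ s)]
    _ = _ := by
        rw [← Real.rpow_natCast (‖freq ξ‖ ^ s), ← Real.rpow_mul (norm_nonneg _), mul_comm s]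
        push_cast
        ring

/-- The symbol `p (2πiξ)^s + q (-2πiξ)^s + a (2πiξ) + b` of the operator in the equation. -/
def opSymbol (p q a b s : ℝ) (ξ : ℝ) : ℂ :=
  p * freq ξ ^ (s : ℂ) + q * (-freq ξ) ^ (s : ℂ) + a * freq ξ + b

theorem measurable_opSymbol (p q a b s : ℝ) : Measurable (opSymbol p q a b s) := by
  have := measurable_freq
  unfold opSymbol
  fun_prop

theorem norm_opSymbol_le (p q a b : ℝ) {s : ℝ} (hs : 1 ≤ s) (ξ : ℝ) :
    ‖opSymbol p q a b s ξ‖ ≤ (|p| + |q| + |a| + |b|) * (1 + ‖freq ξ‖ ^ s) := by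
  have h1 : ‖freq ξ‖ ≤ 1 + ‖freq ξ‖ ^ s := by
    simpa using rpow_le_one_add_rpow (norm_nonneg (freq ξ)) zero_le_one hs
  have h0 := Real.rpow_nonneg (norm_nonneg (freq ξ)) s
  calc _ ≤ ‖(p : ℂ) * freq ξ ^ (s : ℂ)‖ + ‖(q : ℂ) * (-freq ξ) ^ (s : ℂ)‖ + ‖(a : ℂ) * freq ξ‖
        + ‖(b : ℂ)‖ := norm_add₄_le
    _ = |p| * ‖freq ξ‖ ^ s + |q| * ‖freq ξ‖ ^ s + |a| * ‖freq ξ‖ + |b| := by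
        simp only [norm_mul, norm_freq_cpow, norm_neg_freq_cpow, Complex.norm_real,
          Real.norm_eq_abs]
    _ ≤ |p| * (1 + ‖freq ξ‖ ^ s) + |q| * (1 + ‖freq ξ‖ ^ s) + |a| * (1 + ‖freq ξ‖ ^ s)
        + |b| * (1 + ‖freq ξ‖ ^ s) := by
        gcongr
        · linarith
        · linarith
        · exact le_mul_of_one_le_right (abs_nonneg _) (by linarith)
    _ = _ := by ring

theorem IsTestFunction.integrable_mul {w ψ : ℝ → ℝ} (hψ : IsTestFunction ψ)
    (hw : LocallyIntegrable w) : Integrable fun x => w x * ψ x := by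
  simpa [mul_comm] using hw.integrable_smul_left_of_hasCompactSupport hψ.1.continuous hψ.2

theorem integral_plancherel_mul_fourierInv {v : ℝ → ℝ} (hv : MemLp v 2 volume) {ψ : ℝ → ℝ}
    (hψ : IsTestFunction ψ) :
    ∫ ξ, plancherel hv ξ * (𝓕⁻ hψ.schwartz) ξ = ((∫ x, v x * ψ x : ℝ) : ℂ) := by
  have := (integrable_and_integral_mul_multiplier hv hψ (Λ := fun _ => 1) measurable_const
    le_rfl zero_le_two (by simp) (d := ψ) (fun x => by
      simp only [one_mul]
      exact (congrFun hψ.fourier_fourierInv x).symm)).2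
  simpa using this.symm

theorem integral_linear_combination_four {𝕜 : Type*} [RCLike 𝕜] {F G H K : ℝ → 𝕜}
    (hF : Integrable F) (hG : Integrable G) (hH : Integrable H) (hK : Integrable K) (p q a b : 𝕜) :
    ∫ x, (p * F x + q * G x + a * H x + b * K x)
      = p * (∫ x, F x) + q * (∫ x, G x) + a * (∫ x, H x) + b * (∫ x, K x) := by
  have k1 := hF.const_mul p
  have k2 := hG.const_mul q
  have k3 := hH.const_mul a
  have k4 := hK.const_mul b
  have k12 : Integrable fun x => p * F x + q * G x := k1.add k2
  have k123 : Integrable fun x => p * F x + q * G x + a * H x := k12.add k3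
  rw [integral_add k123 k4, integral_add k12 k3, integral_add k1 k2]
  simp only [integral_const_mul]

/-- The transform of a solution satisfies the algebraic equation given by the symbol. -/
theorem IsSolution.plancherel_eq {p q a b μ : ℝ} (hμ : μ ∈ Set.Ioo (0 : ℝ) 1) {f v : ℝ → ℝ}
    (h : IsSolution p q a b μ f v) (hf : MemLp f 2 volume) (hv : MemLp v 2 volume) :
    (fun ξ => opSymbol p q a b (2 - μ) ξ * plancherel hv ξ) =ᵐ[volume] plancherel hf := by
  obtain ⟨⟨hw, hI⟩, uL, uR, u', ⟨-, hL, hL'⟩, ⟨-, hR, hR'⟩, ⟨-, hD, hD'⟩, heq⟩ := h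
  have hs1 : 1 ≤ 2 - μ := by linarith [hμ.2]
  have hs0 : 0 ≤ 2 - μ := by linarith
  have hs2 : 2 - μ ≤ 2 := by linarith [hμ.1]
  have hM := memLp_mul_plancherel hw hI (measurable_opSymbol p q a b (2 - μ))
    (norm_opSymbol_le p q a b hs1)
  have hLp : hM.toLp _ = plancherel hf := by
    refine Lp_eq_of_forall_test fun ψ hψ => ?_
    set θ := 𝓕⁻ hψ.schwartz with hθ
    obtain ⟨iL, eL⟩ := integrable_and_integral_mul_multiplier hv hψ (measurable_freq_cpow (2 - μ))
      hs0 hs2 (norm_freq_cpow _) (rlDerivRight_eq_fourier hμ hψ)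
    obtain ⟨iR, eR⟩ := integrable_and_integral_mul_multiplier hv hψ
      (measurable_neg_freq_cpow (2 - μ)) hs0 hs2 (norm_neg_freq_cpow _)
      (rlDerivLeft_eq_fourier hμ hψ)
    obtain ⟨iD, eD⟩ := integrable_and_integral_mul_multiplier hv hψ measurable_freq.neg
      zero_le_one one_le_two (by simp) (deriv_eq_fourier hψ)
    have e0 := integral_plancherel_mul_fourierInv hv hψ
    have hint : ∀ {Λ : ℝ → ℂ} {k : ℝ}, Measurable Λ → 0 ≤ k → k ≤ 2 →
        (∀ ξ, ‖Λ ξ‖ = ‖freq ξ‖ ^ k) → Integrable fun ξ => plancherel hv ξ * (Λ ξ * θ ξ) :=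
      fun h1 h2 h3 h4 => (Lp.memLp _).integrable_mul (memLp_symbol_mul θ h1 h2 h3 h4)
    have j1 := hint (measurable_freq_cpow (2 - μ)) hs0 hs2 (norm_freq_cpow _)
    have j2 := hint (measurable_neg_freq_cpow (2 - μ)) hs0 hs2 (norm_neg_freq_cpow _)
    have j3 := hint measurable_freq.neg zero_le_one one_le_two (by simp)
    have j4 : Integrable fun ξ => plancherel hv ξ * θ ξ :=
      (Lp.memLp _).integrable_mul (θ.memLp 2 volume)
    have hfe : ∫ x, f x * ψ x = p * (∫ x, uL x * ψ x) + q * (∫ x, uR x * ψ x)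
        + a * (∫ x, u' x * ψ x) + b * (∫ x, v x * ψ x) := by
      rw [← integral_linear_combination_four (hψ.integrable_mul hL) (hψ.integrable_mul hR)
        (hψ.integrable_mul hD) (hψ.integrable_mul (hv.locallyIntegrable (by norm_num)))]
      refine integral_congr_ae ?_
      filter_upwards [heq] with x hx
      rw [← hx]
      ring
    rw [integral_plancherel_mul_fourierInv hf hψ, hfe, ← (hL' ψ hψ).2, ← (hR' ψ hψ).2,
      show ∫ x, u' x * ψ x = - ∫ x, v x * deriv ψ x by rw [hD' ψ hψ, neg_neg]]
    push_cast
    rw [eL, eR, eD, ← e0, ← neg_mul_comm, ← integral_linear_combination_four j1 j2 j3 j4]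
    refine integral_congr_ae ?_
    filter_upwards [hM.coeFn_toLp] with ξ hξ
    rw [hξ]
    simp only [Pi.neg_apply, opSymbol]
    ring
  rw [← hLp]
  exact hM.coeFn_toLp.symm

open ComplexConjugate in
theorem fourierInv_test_neg {ψ : ℝ → ℝ} (hψ : IsTestFunction ψ) (ξ : ℝ) :
    (𝓕⁻ hψ.schwartz) (-ξ) = conj ((𝓕⁻ hψ.schwartz) ξ) := by
  rw [SchwartzMap.fourierInv_coe, Real.fourierInv_eq', Real.fourierInv_eq', ← integral_conj]
  refine integral_congr_ae (ae_of_all _ fun x => ?_)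
  dsimp only
  rw [smul_eq_mul, smul_eq_mul, map_mul, ← Complex.exp_conj, hψ.schwartz_apply,
    Complex.conj_ofReal, map_mul, Complex.conj_ofReal, Complex.conj_I]
  congr 2
  simp

open ComplexConjugate in
/-- The transform of a real function is Hermitian. -/
theorem plancherel_neg {v : ℝ → ℝ} (hv : MemLp v 2 volume) :
    ∀ᵐ ξ, plancherel hv (-ξ) = conj (plancherel hv ξ) := by
  have hG : MemLp (fun ξ => conj (plancherel hv (-ξ))) 2 volume :=
    ((Lp.memLp (plancherel hv)).comp_measurePreserving (Measure.measurePreserving_neg volume)).star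
  have : plancherel hv = hG.toLp _ := by
    refine Lp_eq_of_forall_test fun ψ hψ => ?_
    calc _ = conj (∫ ξ, plancherel hv ξ * (𝓕⁻ hψ.schwartz) ξ) := by
          rw [integral_plancherel_mul_fourierInv hv hψ, Complex.conj_ofReal]
      _ = ∫ ξ, conj (plancherel hv (-ξ) * (𝓕⁻ hψ.schwartz) (-ξ)) := by
          rw [integral_conj]
          exact congrArg conj (integral_neg_eq_self
            (fun ξ => plancherel hv ξ * (𝓕⁻ hψ.schwartz) ξ) volume).symm
      _ = _ := by
          refine integral_congr_ae ?_
          filter_upwards [hG.coeFn_toLp] with ξ hξ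
          rw [hξ, map_mul, fourierInv_test_neg, Complex.conj_conj]
  have h := hG.coeFn_toLp
  rw [← this] at h
  filter_upwards [h] with ξ hξ
  rw [hξ, Complex.conj_conj]

open ComplexConjugate in
/-- The inverse transform of a Hermitian element of `L²` is real. -/
theorem Lp_fourierInv_im_eq_zero {W : Lp ℂ 2 (volume : Measure ℝ)}
    (hW : ∀ᵐ ξ, W (-ξ) = conj (W ξ)) :
    ∀ᵐ x, ((𝓕⁻ W : Lp ℂ 2 (volume : Measure ℝ)) x).im = 0 := by
  set V : Lp ℂ 2 (volume : Measure ℝ) := 𝓕⁻ W with hV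
  have hVl := Lp.locallyIntegrable_coeFn V
  have hVc : MemLp (fun x => conj (V x)) 2 volume := (Lp.memLp V).star
  have : (V : ℝ → ℂ) =ᵐ[volume] fun x => conj (V x) := by
    refine ae_eq_of_forall_test hVl (hVc.locallyIntegrable (by norm_num)) fun ψ hψ => ?_
    calc _ = ∫ ξ, W ξ * (𝓕⁻ hψ.schwartz) ξ := integral_Lp_fourierInv_mul W _
      _ = ∫ ξ, W (-ξ) * (𝓕⁻ hψ.schwartz) (-ξ) := (integral_neg_eq_self
            (fun ξ => W ξ * (𝓕⁻ hψ.schwartz) ξ) volume).symm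
      _ = ∫ ξ, conj (W ξ * (𝓕⁻ hψ.schwartz) ξ) := by
          refine integral_congr_ae ?_
          filter_upwards [hW] with ξ hξ
          rw [hξ, map_mul, fourierInv_test_neg]
      _ = conj (∫ x, V x * hψ.schwartz x) := by
          rw [integral_conj, hV, integral_Lp_fourierInv_mul]
      _ = _ := by
          rw [← integral_conj]
          refine integral_congr_ae (ae_of_all _ fun x => ?_)
          simp [hψ.schwartz_apply]
  filter_upwards [this] with x hx
  exact Complex.conj_eq_iff_im.1 hx.symm

/-- If a multiplier `Λ` sends the transform of `v` to `W ∈ L²`, then the real part of `𝓕⁻ W` is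
the weak derivative of `v` defined by `Λ`. -/
theorem integral_mul_eq_of_multiplier {v : ℝ → ℝ} (hv : MemLp v 2 volume)
    {W : Lp ℂ 2 (volume : Measure ℝ)} {Λ : ℝ → ℂ} (hm : Measurable Λ) {k : ℝ}
    (hk : 0 ≤ k) (hk2 : k ≤ 2) (hb : ∀ ξ, ‖Λ ξ‖ = ‖freq ξ‖ ^ k)
    (hW : (W : ℝ → ℂ) =ᵐ[volume] fun ξ => Λ ξ * plancherel hv ξ)
    {ψ : ℝ → ℝ} (hψ : IsTestFunction ψ) {d : ℝ → ℝ}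
    (hd : ∀ x, (d x : ℂ) = 𝓕 (fun ξ => Λ ξ * (𝓕⁻ hψ.schwartz) ξ) x) :
    Integrable (fun x => v x * d x) ∧
      ∫ x, v x * d x = ∫ x, ((𝓕⁻ W : Lp ℂ 2 (volume : Measure ℝ)) x).re * ψ x := by
  obtain ⟨h1, h2⟩ := integrable_and_integral_mul_multiplier hv hψ hm hk hk2 hb hd
  refine ⟨h1, ?_⟩
  have h3 : ((∫ x, v x * d x : ℝ) : ℂ)
      = ∫ x, (𝓕⁻ W : Lp ℂ 2 (volume : Measure ℝ)) x * hψ.schwartz x := by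
    rw [h2, integral_Lp_fourierInv_mul]
    refine integral_congr_ae ?_
    filter_upwards [hW] with ξ hξ
    rw [hξ]
    ring
  have hint : Integrable fun x => (𝓕⁻ W : Lp ℂ 2 (volume : Measure ℝ)) x * hψ.schwartz x :=
    (Lp.memLp _).integrable_mul (hψ.schwartz.memLp 2 volume)
  rw [← Complex.ofReal_re (∫ x, v x * d x), h3, ← RCLike.re_eq_complex_re, ← integral_re hint]
  refine integral_congr_ae (ae_of_all _ fun x => ?_)
  simp [hψ.schwartz_apply]

/-- A real function in the Sobolev space whose transform satisfies the algebraic equation solves the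
original equation. -/
theorem isSolution_of_plancherel_eq {p q a b μ : ℝ} (hμ : μ ∈ Set.Ioo (0 : ℝ) 1) {f u : ℝ → ℝ}
    (hf : MemLp f 2 volume) (hu : MemLp u 2 volume)
    (hI : Integrable (fun ξ : ℝ =>
      (1 + |2 * Real.pi * ξ| ^ (2 * (2 - μ))) * ‖plancherel hu ξ‖ ^ 2))
    (h : (fun ξ => opSymbol p q a b (2 - μ) ξ * plancherel hu ξ) =ᵐ[volume] plancherel hf) :
    IsSolution p q a b μ f u := by
  have hs1 : 1 ≤ 2 - μ := by linarith [hμ.2]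
  have hs0 : 0 ≤ 2 - μ := by linarith
  have hs2 : 2 - μ ≤ 2 := by linarith [hμ.1]
  have hML := memLp_mul_plancherel hu hI (measurable_freq_cpow (2 - μ)) (C := 1)
    fun ξ => by rw [norm_freq_cpow]; linarith
  have hMR := memLp_mul_plancherel hu hI (measurable_neg_freq_cpow (2 - μ)) (C := 1)
    fun ξ => by rw [norm_neg_freq_cpow]; linarith
  have hMD := memLp_mul_plancherel hu hI measurable_freq (C := 1) fun ξ => by
    simpa using rpow_le_one_add_rpow (norm_nonneg (freq ξ)) zero_le_one hs1
  set WL := hML.toLp _ with hWL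
  set WR := hMR.toLp _ with hWR
  set WD := hMD.toLp _ with hWD
  have hloc : ∀ W : Lp ℂ 2 (volume : Measure ℝ), LocallyIntegrable fun x => (W x).re := fun W =>
    (Lp.memLp W).re.locallyIntegrable (by norm_num)
  have hul := hu.locallyIntegrable (by norm_num : (1 : ENNReal) ≤ 2)
  refine ⟨⟨hu, hI⟩, fun x => ((𝓕⁻ WL : Lp ℂ 2 (volume : Measure ℝ)) x).re,
    fun x => ((𝓕⁻ WR : Lp ℂ 2 (volume : Measure ℝ)) x).re,
    fun x => ((𝓕⁻ WD : Lp ℂ 2 (volume : Measure ℝ)) x).re,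
    ⟨hul, hloc _, fun ψ hψ => ?_⟩, ⟨hul, hloc _, fun ψ hψ => ?_⟩,
    ⟨hul, hloc _, fun ψ hψ => ?_⟩, ?_⟩
  · exact integral_mul_eq_of_multiplier hu (measurable_freq_cpow _) hs0 hs2 (norm_freq_cpow _)
      hML.coeFn_toLp hψ (rlDerivRight_eq_fourier hμ hψ)
  · exact integral_mul_eq_of_multiplier hu (measurable_neg_freq_cpow _) hs0 hs2
      (norm_neg_freq_cpow _) hMR.coeFn_toLp hψ (rlDerivLeft_eq_fourier hμ hψ)
  · have := (integral_mul_eq_of_multiplier hu measurable_freq zero_le_one one_le_two (by simp)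
      hMD.coeFn_toLp hψ (d := fun x => -deriv ψ x) (fun x => by
        rw [Complex.ofReal_neg, deriv_eq_fourier hψ, fourier_eq_integral_freq,
          fourier_eq_integral_freq, ← integral_neg]
        simp only [neg_mul, mul_neg, neg_neg])).2
    simp only [mul_neg, integral_neg] at this
    linarith
  · have hsum : (p : ℂ) • WL + (q : ℂ) • WR + (a : ℂ) • WD + (b : ℂ) • plancherel hu
        = plancherel hf := by
      refine Lp.ext ?_
      filter_upwards [h, Lp.coeFn_add ((p : ℂ) • WL + (q : ℂ) • WR + (a : ℂ) • WD)
        ((b : ℂ) • plancherel hu), Lp.coeFn_add ((p : ℂ) • WL + (q : ℂ) • WR) ((a : ℂ) • WD),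
        Lp.coeFn_add ((p : ℂ) • WL) ((q : ℂ) • WR), Lp.coeFn_smul (p : ℂ) WL,
        Lp.coeFn_smul (q : ℂ) WR, Lp.coeFn_smul (a : ℂ) WD, Lp.coeFn_smul (b : ℂ) (plancherel hu),
        hML.coeFn_toLp, hMR.coeFn_toLp, hMD.coeFn_toLp] with ξ h0 h1 h2 h3 h4 h5 h6 h7 h8 h9 h10
      rw [h1, Pi.add_apply, h2, Pi.add_apply, h3, Pi.add_apply, h4, h5, h6, h7, Pi.smul_apply,
        Pi.smul_apply, Pi.smul_apply, Pi.smul_apply, h8, h9, h10, ← h0]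
      simp only [opSymbol, smul_eq_mul]
      ring
    have hinv := congrArg (fun W : Lp ℂ 2 (volume : Measure ℝ) => 𝓕⁻ W) hsum
    simp only [FourierTransform.fourierInv_add, FourierTransform.fourierInv_smul] at hinv
    rw [plancherel, plancherel, FourierTransform.fourierInv_fourier_eq,
      FourierTransform.fourierInv_fourier_eq] at hinv
    set VL : Lp ℂ 2 (volume : Measure ℝ) := 𝓕⁻ WL
    set VR : Lp ℂ 2 (volume : Measure ℝ) := 𝓕⁻ WR
    set VD : Lp ℂ 2 (volume : Measure ℝ) := 𝓕⁻ WD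
    have hcu : (hu.ofReal.toLp (fun x => (u x : ℂ)) : ℝ → ℂ) =ᵐ[volume] fun x => (u x : ℂ) :=
      MemLp.coeFn_toLp _
    have hcf : (hf.ofReal.toLp (fun x => (f x : ℂ)) : ℝ → ℂ) =ᵐ[volume] fun x => (f x : ℂ) :=
      MemLp.coeFn_toLp _
    rw [← hinv] at hcf
    filter_upwards [hcu, hcf, Lp.coeFn_add ((p : ℂ) • VL + (q : ℂ) • VR + (a : ℂ) • VD)
        ((b : ℂ) • hu.ofReal.toLp (fun x => (u x : ℂ))),
        Lp.coeFn_add ((p : ℂ) • VL + (q : ℂ) • VR) ((a : ℂ) • VD),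
        Lp.coeFn_add ((p : ℂ) • VL) ((q : ℂ) • VR), Lp.coeFn_smul (p : ℂ) VL,
        Lp.coeFn_smul (q : ℂ) VR, Lp.coeFn_smul (a : ℂ) VD,
        Lp.coeFn_smul (b : ℂ) (hu.ofReal.toLp (fun x => (u x : ℂ)))]
      with x h8 h9 h1 h2 h3 h4 h5 h6 h7
    rw [h1, Pi.add_apply, h2, Pi.add_apply, h3, Pi.add_apply, h4, h5, h6, h7, Pi.smul_apply,
      Pi.smul_apply, Pi.smul_apply, Pi.smul_apply, h8] at h9
    have := congrArg Complex.re h9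
    simpa using this

/-! ### Ellipticity of the symbol -/

/-- The expression `∑ C_j w^(2σ_j)`, which is the squared modulus of the symbol at frequency
`w = |2πξ|`. -/
def symbolNormSq (p q a b μ w : ℝ) : ℝ :=
  coeffC p q a b μ 1 * w ^ (2 * sigmaExp μ 1) + coeffC p q a b μ 2 * w ^ (2 * sigmaExp μ 2)
    + coeffC p q a b μ 3 * w ^ (2 * sigmaExp μ 3) + coeffC p q a b μ 4 * w ^ (2 * sigmaExp μ 4)
    + b ^ 2

theorem ofReal_mul_I_cpow {w : ℝ} (hw : 0 < w) (s : ℝ) :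
    ((w : ℂ) * Complex.I) ^ (s : ℂ) = (w ^ s : ℝ) *
      ((Real.cos (s * Real.pi / 2) : ℝ) + (Real.sin (s * Real.pi / 2) : ℝ) * Complex.I) := by
  have h0 : (w : ℂ) * Complex.I ≠ 0 := by simp [hw.ne']
  rw [Complex.cpow_def_of_ne_zero h0, Complex.log_ofReal_mul hw Complex.I_ne_zero, Complex.log_I,
    add_mul, Complex.exp_add, Complex.ofReal_cos, Complex.ofReal_sin, ← Complex.exp_mul_I,
    Real.rpow_def_of_pos hw, Complex.ofReal_exp]
  congr 2
  · push_cast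
    ring
  · push_cast
    ring

theorem ofReal_mul_neg_I_cpow {w : ℝ} (hw : 0 < w) (s : ℝ) :
    (-((w : ℂ) * Complex.I)) ^ (s : ℂ) = (w ^ s : ℝ) *
      ((Real.cos (s * Real.pi / 2) : ℝ) - (Real.sin (s * Real.pi / 2) : ℝ) * Complex.I) := by
  have h0 : (w : ℂ) * -Complex.I ≠ 0 := by simp [hw.ne']
  have h1 : ((Real.cos (s * Real.pi / 2) : ℝ) : ℂ) - (Real.sin (s * Real.pi / 2) : ℝ) * Complex.I
      = Complex.cos ((-(s * Real.pi / 2) : ℝ) : ℂ)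
        + Complex.sin ((-(s * Real.pi / 2) : ℝ) : ℂ) * Complex.I := by
    rw [← Complex.ofReal_cos, ← Complex.ofReal_sin, Real.cos_neg, Real.sin_neg]
    push_cast
    ring
  rw [← mul_neg, Complex.cpow_def_of_ne_zero h0,
    Complex.log_ofReal_mul hw (neg_ne_zero.2 Complex.I_ne_zero), Complex.log_neg_I,
    add_mul, Complex.exp_add, h1, ← Complex.exp_mul_I,
    Real.rpow_def_of_pos hw, Complex.ofReal_exp]
  congr 2
  · push_cast
    ring
  · push_cast
    ring

/-- The squared modulus of the symbol, from `(±iw)^s = w^s (cos(sπ/2) ± i sin(sπ/2))`; by the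
double angle formula the coefficients are the constants `C_j`. -/
theorem norm_opSymbol_sq (p q a b μ : ℝ) (hμ : μ ∈ Set.Ioo (0 : ℝ) 1) (ξ : ℝ) :
    ‖opSymbol p q a b (2 - μ) ξ‖ ^ 2 = symbolNormSq p q a b μ ‖freq ξ‖ := by
  have h1 := hμ.1
  have h2 := hμ.2
  rcases eq_or_ne ξ 0 with rfl | hξ
  · have h0 : freq 0 = 0 := by simp [freq]
    have hc : ((2 - μ : ℝ) : ℂ) ≠ 0 := by
      rw [Complex.ofReal_ne_zero]
      linarith
    simp only [opSymbol, symbolNormSq, h0, norm_zero, neg_zero, sigmaExp]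
    rw [Complex.zero_cpow hc, Real.zero_rpow (by linarith), Real.zero_rpow (by linarith),
      Real.zero_rpow (by norm_num), Real.zero_rpow (by linarith)]
    simp
  · set w := ‖freq ξ‖ with hwdef
    have hw : 0 < w := norm_pos_iff.2 (freq_ne_zero hξ)
    set c := Real.cos ((2 - μ) * Real.pi / 2) with hc
    set S := Real.sin ((2 - μ) * Real.pi / 2) with hS
    have hcS : S ^ 2 + c ^ 2 = 1 := Real.sin_sq_add_cos_sq _
    have hrhs : symbolNormSq p q a b μ w = ((p + q) * w ^ (2 - μ) * c + b) ^ 2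
        + ((p - q) * w ^ (2 - μ) * S + a * w) ^ 2 := by
      have e1 : Real.cos ((2 - μ) * Real.pi) = c ^ 2 - S ^ 2 := by
        rw [show (2 - μ) * Real.pi = 2 * ((2 - μ) * Real.pi / 2) by ring, Real.cos_two_mul, ← hc]
        linarith
      have e2 : Real.cos ((3 - μ) / 2 * Real.pi) = -S := by
        rw [show (3 - μ) / 2 * Real.pi = (2 - μ) * Real.pi / 2 + Real.pi / 2 by ring,
          Real.cos_add_pi_div_two]
      have e4 : Real.cos ((2 - μ) / 2 * Real.pi) = c := by
        rw [hc]
        congr 1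
        ring
      have w1 : w ^ (2 * (2 - μ)) = (w ^ (2 - μ)) ^ 2 := by
        rw [← Real.rpow_natCast, ← Real.rpow_mul hw.le, mul_comm]
        norm_num
      have w2 : w ^ (2 * ((3 - μ) / 2)) = w ^ (2 - μ) * w := by
        rw [← Real.rpow_add_one hw.ne']
        congr 1
        ring
      have w3 : w ^ (2 * (1 : ℝ)) = w ^ 2 := by norm_num
      have w4 : w ^ (2 * ((2 - μ) / 2)) = w ^ (2 - μ) := by
        congr 1
        ring
      simp only [symbolNormSq, coeffC, sigmaExp]
      rw [e1, e2, e4, w1, w2, w3, w4]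
      linear_combination (-(p ^ 2 + q ^ 2) * (w ^ (2 - μ)) ^ 2) * hcS
    rw [hrhs]
    have key : ∀ P Q : ℝ, ‖((P : ℂ) + Q * Complex.I)‖ ^ 2 = P ^ 2 + Q ^ 2 := fun P Q => by
      rw [← Complex.normSq_eq_norm_sq, Complex.normSq_add_mul_I]
    rcases lt_or_gt_of_ne hξ with hneg | hpos
    · have hf : freq ξ = -((w : ℂ) * Complex.I) := by
        rw [hwdef, norm_freq, abs_of_neg hneg]
        simp only [freq]
        push_cast
        ring
      rw [opSymbol, hf, neg_neg, ofReal_mul_I_cpow hw, ofReal_mul_neg_I_cpow hw, ← hc, ← hS,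
        ← neg_sq ((p - q) * w ^ (2 - μ) * S + a * w), ← key]
      congr 2
      push_cast
      ring
    · have hf : freq ξ = (w : ℂ) * Complex.I := by
        rw [hwdef, norm_freq, abs_of_pos hpos]
        simp only [freq]
        push_cast
        ring
      rw [opSymbol, hf, ofReal_mul_I_cpow hw, ofReal_mul_neg_I_cpow hw, ← hc, ← hS, ← key]
      congr 2
      push_cast
      ring

theorem coeffC_one_pos {p q a b μ : ℝ} (hpq : p ^ 2 + q ^ 2 ≠ 0) (hμ : μ ∈ Set.Ioo (0 : ℝ) 1) :
    0 < coeffC p q a b μ 1 := by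
  have hpos : 0 < p ^ 2 + q ^ 2 := lt_of_le_of_ne (by positivity) (Ne.symm hpq)
  simp only [coeffC, sigmaExp]
  set k := Real.cos ((2 - μ) * Real.pi) with hk
  have hsin : Real.sin ((2 - μ) * Real.pi) ≠ 0 := by
    have : Real.sin ((2 - μ) * Real.pi) = -Real.sin (μ * Real.pi) := by
      rw [sub_mul, Real.sin_two_pi_sub]
    rw [this, neg_ne_zero]
    refine (Real.sin_pos_of_pos_of_lt_pi (by have := hμ.1; positivity) ?_).ne'
    have := mul_lt_mul_of_pos_right hμ.2 Real.pi_pos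
    linarith
  have hk1 : k ^ 2 < 1 := by
    have := Real.sin_sq_add_cos_sq ((2 - μ) * Real.pi)
    have h2 : 0 < Real.sin ((2 - μ) * Real.pi) ^ 2 := by positivity
    rw [← hk] at this
    linarith
  obtain ⟨h1, h2⟩ := abs_lt.1 ((sq_lt_one_iff_abs_lt_one k).1 hk1)
  -- `C_1` is the combination `(1 - k)/2 (p - q)² + (1 + k)/2 (p + q)²` with positive weights.
  nlinarith [mul_nonneg (sub_nonneg.2 h2.le) (sq_nonneg (p - q)),
    mul_nonneg (show 0 ≤ 1 + k by linarith) (sq_nonneg (p + q)), mul_pos (sub_pos.2 h2) hpos,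
    mul_pos (show 0 < 1 + k by linarith) hpos]

/-- The condition on the coefficients makes the squared modulus of the symbol positive. With
`w = t / α`, the negative terms are absorbed by `b²` for `t ≤ 1` and by the terms of higher order
for `t ≥ 1`. -/
theorem symbolNormSq_pos {p q a b μ : ℝ} (hb : b ≠ 0) (hpq : p ^ 2 + q ^ 2 ≠ 0)
    (hμ : μ ∈ Set.Ioo (0 : ℝ) 1) (hC : CoeffCondition p q a b μ) {w : ℝ} (hw : 0 ≤ w) :
    0 < symbolNormSq p q a b μ w := by
  have hC1 := coeffC_one_pos (a := a) (b := b) hpq hμ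
  have hC3 : 0 ≤ coeffC p q a b μ 3 := sq_nonneg a
  have hb2 : 0 < b ^ 2 := by positivity
  obtain ⟨h0, h1⟩ := hμ
  unfold symbolNormSq
  simp only [CoeffCondition] at hC
  generalize coeffC p q a b μ = C at *
  -- In terms of `t = w α`, both inequalities for `α` involve the `C_j` only through `C_j R_j`,
  -- the coefficients of the powers of `t`.
  have hscale : ∀ {α : ℝ}, 0 < α → ∀ σ : ℝ, ∃ R : ℝ, 0 < R ∧ α ^ (2 * ((0 : ℝ) - σ)) = R ∧
      (α ^ (2 * σ - 1))⁻¹ = α * R ∧ w ^ (2 * σ) = R * (w * α) ^ (2 * σ) := by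
    intro α hα σ
    refine ⟨α ^ (2 * ((0 : ℝ) - σ)), by positivity, rfl, ?_, ?_⟩
    · rw [← Real.rpow_neg hα.le, mul_comm α, ← Real.rpow_add_one hα.ne']
      congr 1
      ring
    · rw [Real.mul_rpow hw hα.le, mul_left_comm, ← Real.rpow_add hα]
      ring_nf
      simp
  have hsum14 : ∀ g : ℕ → ℝ, ∑ j ∈ Finset.Icc 1 4, g j = g 1 + g 2 + g 3 + g 4 := fun g => by
    simp [Finset.sum_Icc_succ_top]
  have hsum24 : ∀ g : ℕ → ℝ, ∑ j ∈ Finset.Icc 2 4, g j = g 2 + g 3 + g 4 := fun g => by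
    simp [Finset.sum_Icc_succ_top]
  have hsum12 : ∀ g : ℕ → ℝ, ∑ j ∈ Finset.Icc 1 2, g j = g 1 + g 2 := fun g => by
    simp [Finset.sum_Icc_succ_top]
  have hsum2_4 : ∀ g : ℕ → ℝ, ∑ j ∈ ({2, 4} : Finset ℕ), g j = g 2 + g 4 := fun g => by simp
  have hsum1_2_4 : ∀ g : ℕ → ℝ, ∑ j ∈ ({1, 2, 4} : Finset ℕ), g j = g 1 + g 2 + g 4 := fun g => by
    simp [add_assoc]
  simp only [hsum14, hsum24, hsum12, hsum2_4, hsum1_2_4] at hC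
  have h5 : sigmaExp μ 5 = 0 := rfl
  rw [h5] at hC
  rcases hC with ⟨h2, h4⟩ | ⟨h2, h4, α, hα, hA, hB⟩ | ⟨h2, h4, α, hα, hA, hB⟩ |
    ⟨h2, h4, α, hα, hA, hB⟩
  · positivity
  all_goals
    obtain ⟨R1, hR1, a1, b1, c1⟩ := hscale hα (sigmaExp μ 1)
    obtain ⟨R2, hR2, a2, b2, c2⟩ := hscale hα (sigmaExp μ 2)
    obtain ⟨R3, hR3, a3, b3, c3⟩ := hscale hα (sigmaExp μ 3)
    obtain ⟨R4, hR4, a4, b4, c4⟩ := hscale hα (sigmaExp μ 4)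
    simp only [a2, a3, a4] at hA
    simp only [div_eq_mul_inv, b1, b2, b3, b4] at hB
    rw [c1, c2, c3, c4]
    have ht : 0 ≤ w * α := by positivity
    generalize w * α = t at ht
    have hT1 := Real.rpow_nonneg ht (2 * sigmaExp μ 1)
    have hT2 := Real.rpow_nonneg ht (2 * sigmaExp μ 2)
    have hT3 := Real.rpow_nonneg ht (2 * sigmaExp μ 3)
    have hT4 := Real.rpow_nonneg ht (2 * sigmaExp μ 4)
    have hlow : t ≤ 1 → t ^ (2 * sigmaExp μ 2) ≤ t ^ (2 * sigmaExp μ 3) ∧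
        t ^ (2 * sigmaExp μ 3) ≤ t ^ (2 * sigmaExp μ 4) ∧ t ^ (2 * sigmaExp μ 4) ≤ 1 := by
      intro h
      simp only [sigmaExp]
      exact ⟨Real.rpow_le_rpow_of_exponent_ge' ht h (by linarith) (by linarith),
        Real.rpow_le_rpow_of_exponent_ge' ht h (by linarith) (by linarith),
        Real.rpow_le_one ht h (by linarith)⟩
    have hhigh : 1 ≤ t → t ^ (2 * sigmaExp μ 2) ≤ t ^ (2 * sigmaExp μ 1) ∧
        t ^ (2 * sigmaExp μ 3) ≤ t ^ (2 * sigmaExp μ 2) ∧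
        t ^ (2 * sigmaExp μ 4) ≤ t ^ (2 * sigmaExp μ 3) ∧ 1 ≤ t ^ (2 * sigmaExp μ 4) := by
      intro h
      simp only [sigmaExp]
      exact ⟨Real.rpow_le_rpow_of_exponent_le h (by linarith),
        Real.rpow_le_rpow_of_exponent_le h (by linarith),
        Real.rpow_le_rpow_of_exponent_le h (by linarith), Real.one_le_rpow h (by linarith)⟩
    generalize t ^ (2 * sigmaExp μ 1) = T1 at *
    generalize t ^ (2 * sigmaExp μ 2) = T2 at *
    generalize t ^ (2 * sigmaExp μ 3) = T3 at *
    generalize t ^ (2 * sigmaExp μ 4) = T4 at *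
    have d1 := mul_pos hC1 hR1
    have d3 := mul_nonneg hC3 hR3.le
    simp only [mul_left_comm _ α, ← mul_add] at hB
    replace hB := (mul_pos_iff_of_pos_left hα).1 hB
    simp only [← mul_assoc]
  -- Only the fourth term is negative: it is at least `C_4 R_4` for `t ≤ 1`; for `t ≥ 1` the terms of
  -- higher order are compared with `t^(2σ₄)`.
  · have d2 := mul_nonneg h2 hR2.le
    have d4 := mul_neg_of_neg_of_pos h4 hR4
    generalize C 1 * R1 = r1 at *
    generalize C 2 * R2 = r2 at *
    generalize C 3 * R3 = r3 at *
    generalize C 4 * R4 = r4 at *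
    rcases le_total t 1 with h | h
    · obtain ⟨g1, g2, g3⟩ := hlow h
      have : r4 * 1 ≤ r4 * T4 := mul_le_mul_of_nonpos_left g3 d4.le
      have := mul_nonneg d1.le hT1
      have := mul_nonneg d2 hT2
      have := mul_nonneg d3 hT3
      linarith
    · obtain ⟨g1, g2, g3, g4⟩ := hhigh h
      have := mul_le_mul_of_nonneg_left (g3.trans (g2.trans g1)) d1.le
      have := mul_le_mul_of_nonneg_left (g3.trans g2) d2
      have := mul_le_mul_of_nonneg_left g3 d3
      have := mul_pos hB (show 0 < T4 by linarith)
      linarith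
  -- Only the second term is negative: compare with `t^(2σ₂)`, which may vanish at `t = 0`.
  · have d2 := mul_neg_of_neg_of_pos h2 hR2
    have d4 := mul_nonneg h4 hR4.le
    generalize C 1 * R1 = r1 at *
    generalize C 2 * R2 = r2 at *
    generalize C 3 * R3 = r3 at *
    generalize C 4 * R4 = r4 at *
    rcases le_total t 1 with h | h
    · obtain ⟨g1, g2, g3⟩ := hlow h
      have := mul_nonneg d1.le hT1
      have := mul_le_mul_of_nonneg_left g1 d3
      have := mul_le_mul_of_nonneg_left (g1.trans g2) d4
      have : -(b ^ 2) * 1 ≤ -(b ^ 2) * T2 :=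
        mul_le_mul_of_nonpos_left (g1.trans (g2.trans g3)) (by linarith)
      rcases hT2.eq_or_lt with h' | h'
      · have : r2 * T2 = 0 := by rw [← h', mul_zero]
        have := mul_nonneg d3 hT3
        have := mul_nonneg d4 hT4
        linarith
      · have := mul_pos (show 0 < r2 + r3 + r4 + b ^ 2 by linarith) h'
        linarith
    · obtain ⟨g1, g2, g3, g4⟩ := hhigh h
      have := mul_le_mul_of_nonneg_left g1 d1.le
      have := mul_pos hB (show 0 < T2 by linarith)
      have := mul_nonneg d3 hT3
      have := mul_nonneg d4 hT4
      linarith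
  -- Both are negative: compare them with `1` for `t ≤ 1`, and all terms with `t^(2σ₂)` for `t ≥ 1`.
  · have d2 := mul_neg_of_neg_of_pos h2 hR2
    have d4 := mul_neg_of_neg_of_pos h4 hR4
    generalize C 1 * R1 = r1 at *
    generalize C 2 * R2 = r2 at *
    generalize C 3 * R3 = r3 at *
    generalize C 4 * R4 = r4 at *
    have := mul_nonneg d1.le hT1
    have := mul_nonneg d3 hT3
    rcases le_total t 1 with h | h
    · obtain ⟨g1, g2, g3⟩ := hlow h
      have : r2 * 1 ≤ r2 * T2 := mul_le_mul_of_nonpos_left (g1.trans (g2.trans g3)) d2.le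
      have : r4 * 1 ≤ r4 * T4 := mul_le_mul_of_nonpos_left g3 d4.le
      linarith
    · obtain ⟨g1, g2, g3, g4⟩ := hhigh h
      have := mul_le_mul_of_nonneg_left g1 d1.le
      have := mul_le_mul_of_nonpos_left (g3.trans g2) d4.le
      have := mul_pos hB (show 0 < T2 by linarith)
      linarith

open Filter Topology in
/-- The symbol is elliptic: its modulus is bounded below by a multiple of `1 + |2πξ|^(2-μ)`. -/
theorem exists_le_norm_opSymbol {p q a b μ : ℝ} (hb : b ≠ 0) (hpq : p ^ 2 + q ^ 2 ≠ 0)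
    (hμ : μ ∈ Set.Ioo (0 : ℝ) 1) (hC : CoeffCondition p q a b μ) :
    ∃ c, 0 < c ∧ ∀ ξ, c * (1 + ‖freq ξ‖ ^ (2 - μ)) ≤ ‖opSymbol p q a b (2 - μ) ξ‖ := by
  have h0 := hμ.1
  have h1 := hμ.2
  have hC1 := coeffC_one_pos (a := a) (b := b) hpq hμ
  -- The quotient of the squared modulus by its principal part tends to `C_1`.
  have hlim : Tendsto (fun w : ℝ => symbolNormSq p q a b μ w / w ^ (2 * (2 - μ))) atTop
      (𝓝 (coeffC p q a b μ 1)) := by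
    have hneg : ∀ {r : ℝ}, 0 < r → Tendsto (fun w : ℝ => w ^ (-r)) atTop (𝓝 0) := fun hr =>
      tendsto_rpow_neg_atTop hr
    have ht := ((((hneg (show 0 < 1 - μ by linarith)).const_mul (coeffC p q a b μ 2)).add
      ((hneg (show 0 < 2 - 2 * μ by linarith)).const_mul (coeffC p q a b μ 3))).add
      ((hneg (show 0 < 2 - μ by linarith)).const_mul (coeffC p q a b μ 4))).add
      ((hneg (show 0 < 2 * (2 - μ) by linarith)).const_mul (b ^ 2))
    have ht := ht.const_add (coeffC p q a b μ 1)
    simp only [mul_zero, add_zero] at ht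
    refine ht.congr' ?_
    filter_upwards [eventually_gt_atTop 0] with w hw
    have key : ∀ r t : ℝ, r - 2 * (2 - μ) = -t →
        w ^ (-t) = w ^ r / w ^ (2 * (2 - μ)) := fun r t h => by
      rw [← Real.rpow_sub hw, h]
    have hp : w ^ (2 * (2 - μ)) ≠ 0 := (Real.rpow_pos_of_pos hw _).ne'
    simp only [symbolNormSq, sigmaExp]
    rw [key (2 * ((3 - μ) / 2)) (1 - μ) (by ring), key (2 * 1) (2 - 2 * μ) (by ring),
      key (2 * ((2 - μ) / 2)) (2 - μ) (by ring), key 0 (2 * (2 - μ)) (by ring), Real.rpow_zero]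
    field_simp
    ring
  obtain ⟨N, hN⟩ := (eventually_atTop.1 (hlim.eventually_const_lt
    (show coeffC p q a b μ 1 / 2 < coeffC p q a b μ 1 by linarith)))
  set M := max N 1 with hM
  have hM1 : 1 ≤ M := le_max_right _ _
  have hcont : ContinuousOn (symbolNormSq p q a b μ) (Set.Icc 0 M) := by
    have hc : ∀ {r : ℝ}, 0 ≤ r → Continuous fun w : ℝ => w ^ r := fun hr =>
      Real.continuous_rpow_const hr
    have c1 := hc (show 0 ≤ 2 * sigmaExp μ 1 by simp only [sigmaExp]; linarith)
    have c2 := hc (show 0 ≤ 2 * sigmaExp μ 2 by simp only [sigmaExp]; linarith)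
    have c3 := hc (show 0 ≤ 2 * sigmaExp μ 3 by simp only [sigmaExp]; linarith)
    have c4 := hc (show 0 ≤ 2 * sigmaExp μ 4 by simp only [sigmaExp]; linarith)
    refine Continuous.continuousOn ?_
    unfold symbolNormSq
    fun_prop
  obtain ⟨w0, hw0, hmin⟩ := isCompact_Icc.exists_isMinOn
    (Set.nonempty_Icc.2 (show (0 : ℝ) ≤ M by linarith)) hcont
  have hm0 := symbolNormSq_pos hb hpq hμ hC hw0.1
  set m := symbolNormSq p q a b μ w0
  have hMp : 0 < 1 + M ^ (2 - μ) := by positivity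
  set d := min (m / (1 + M ^ (2 - μ)) ^ 2) (coeffC p q a b μ 1 / 8) with hd
  have hd0 : 0 < d := lt_min (by positivity) (by positivity)
  refine ⟨Real.sqrt d, Real.sqrt_pos.2 hd0, fun ξ => ?_⟩
  refine le_of_sq_le_sq ?_ (norm_nonneg _)
  rw [norm_opSymbol_sq _ _ _ _ _ hμ, mul_pow, Real.sq_sqrt hd0.le]
  set w := ‖freq ξ‖ with hwdef
  have hw : 0 ≤ w := norm_nonneg _
  have hwp : 0 ≤ w ^ (2 - μ) := by positivity
  rcases le_total w M with h | h
  · have h2 : 1 + w ^ (2 - μ) ≤ 1 + M ^ (2 - μ) := by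
      have := Real.rpow_le_rpow hw h (show 0 ≤ 2 - μ by linarith)
      linarith
    calc d * (1 + w ^ (2 - μ)) ^ 2
        ≤ m / (1 + M ^ (2 - μ)) ^ 2 * (1 + M ^ (2 - μ)) ^ 2 := by
          gcongr
          exact min_le_left _ _
      _ = m := by field_simp
      _ ≤ _ := hmin ⟨hw, h⟩
  · have h3 := hN w ((le_max_left _ _).trans h)
    have h4 : 1 ≤ w ^ (2 - μ) := Real.one_le_rpow (hM1.trans h) (by linarith)
    have h5 : w ^ (2 * (2 - μ)) = (w ^ (2 - μ)) ^ 2 := by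
      rw [← Real.rpow_natCast, ← Real.rpow_mul hw, mul_comm]
      norm_num
    rw [lt_div_iff₀ (by rw [h5]; positivity), h5] at h3
    calc d * (1 + w ^ (2 - μ)) ^ 2
        ≤ coeffC p q a b μ 1 / 8 * (2 * w ^ (2 - μ)) ^ 2 := by
          gcongr
          · exact min_le_right _ _
          · linarith
      _ = coeffC p q a b μ 1 / 2 * (w ^ (2 - μ)) ^ 2 := by ring
      _ ≤ _ := h3.le

/-! ### Symbol estimates -/

/-- `m` satisfies the estimates of a symbol of order `r` up to the `n`-th derivative: away from the
origin it is `n` times differentiable, and `m^(j) = O(|ξ|^(r - j))` for `|ξ| ≥ 1`, `j ≤ n`. -/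
def IsSymbol : ℕ → ℝ → (ℝ → ℂ) → Prop
  | 0, r, m => ∃ C, ∀ ξ : ℝ, 1 ≤ |ξ| → ‖m ξ‖ ≤ C * |ξ| ^ r
  | n + 1, r, m => (∃ C, ∀ ξ : ℝ, 1 ≤ |ξ| → ‖m ξ‖ ≤ C * |ξ| ^ r) ∧
      (∀ ξ, ξ ≠ 0 → DifferentiableAt ℝ m ξ) ∧ IsSymbol n (r - 1) (deriv m)

namespace IsSymbol

theorem bound {n : ℕ} {r : ℝ} {m : ℝ → ℂ} (h : IsSymbol n r m) :
    ∃ C, 0 ≤ C ∧ ∀ ξ : ℝ, 1 ≤ |ξ| → ‖m ξ‖ ≤ C * |ξ| ^ r := by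
  have : ∃ C, ∀ ξ : ℝ, 1 ≤ |ξ| → ‖m ξ‖ ≤ C * |ξ| ^ r := by
    cases n with
    | zero => exact h
    | succ n => exact h.1
  obtain ⟨C, hC⟩ := this
  refine ⟨|C|, abs_nonneg C, fun ξ hξ => (hC ξ hξ).trans ?_⟩
  gcongr
  exact le_abs_self C

theorem of_succ {n : ℕ} {r : ℝ} {m : ℝ → ℂ} (h : IsSymbol (n + 1) r m) : IsSymbol n r m := by
  induction n generalizing r m with
  | zero => exact h.1
  | succ n ih => exact ⟨h.1, h.2.1, ih h.2.2⟩

theorem mono {n : ℕ} {r t : ℝ} (hrt : r ≤ t) {m : ℝ → ℂ} (h : IsSymbol n r m) :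
    IsSymbol n t m := by
  have key : ∀ {r t : ℝ} {m : ℝ → ℂ}, r ≤ t →
      (∃ C, 0 ≤ C ∧ ∀ ξ : ℝ, 1 ≤ |ξ| → ‖m ξ‖ ≤ C * |ξ| ^ r) →
      ∃ C, ∀ ξ : ℝ, 1 ≤ |ξ| → ‖m ξ‖ ≤ C * |ξ| ^ t := by
    rintro r t m hrt ⟨C, hC0, hC⟩
    refine ⟨C, fun ξ hξ => (hC ξ hξ).trans ?_⟩
    gcongr
  induction n generalizing r t m with
  | zero => exact key hrt h.bound
  | succ n ih => exact ⟨key hrt h.bound, h.2.1, ih (by linarith) h.2.2⟩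

theorem congr {n : ℕ} {r : ℝ} {m m' : ℝ → ℂ} (h : IsSymbol n r m)
    (he : ∀ ξ, ξ ≠ 0 → m' ξ = m ξ) : IsSymbol n r m' := by
  have key : ∀ {r : ℝ} {m m' : ℝ → ℂ}, (∀ ξ, ξ ≠ 0 → m' ξ = m ξ) →
      (∃ C, 0 ≤ C ∧ ∀ ξ : ℝ, 1 ≤ |ξ| → ‖m ξ‖ ≤ C * |ξ| ^ r) →
      ∃ C, ∀ ξ : ℝ, 1 ≤ |ξ| → ‖m' ξ‖ ≤ C * |ξ| ^ r := by
    rintro r m m' he ⟨C, -, hC⟩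
    refine ⟨C, fun ξ hξ => ?_⟩
    rw [he ξ (by rintro rfl; norm_num at hξ)]
    exact hC ξ hξ
  induction n generalizing r m m' with
  | zero => exact key he h.bound
  | succ n ih =>
    have hev : ∀ ξ, ξ ≠ 0 → m' =ᶠ[nhds ξ] m := fun ξ hξ => by
      filter_upwards [isOpen_ne.mem_nhds hξ] with y hy using he y hy
    exact ⟨key he h.bound, fun ξ hξ => (h.2.1 ξ hξ).congr_of_eventuallyEq (hev ξ hξ),
      ih h.2.2 fun ξ hξ => (hev ξ hξ).deriv_eq⟩

theorem zero (n : ℕ) (r : ℝ) : IsSymbol n r fun _ => 0 := by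
  induction n generalizing r with
  | zero => exact ⟨0, fun ξ _ => by simp⟩
  | succ n ih =>
    refine ⟨⟨0, fun ξ _ => by simp⟩, fun _ _ => differentiableAt_const _, ?_⟩
    simpa using ih (r - 1)

theorem const (n : ℕ) (c : ℂ) : IsSymbol n 0 fun _ => c := by
  have hb : ∃ C, ∀ ξ : ℝ, 1 ≤ |ξ| → ‖c‖ ≤ C * |ξ| ^ (0 : ℝ) := ⟨‖c‖, fun ξ _ => by simp⟩
  cases n with
  | zero => exact hb
  | succ n =>
    refine ⟨hb, fun _ _ => differentiableAt_const _, ?_⟩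
    simpa using zero n (0 - 1)

theorem add {n : ℕ} {r : ℝ} {m m' : ℝ → ℂ} (h : IsSymbol n r m) (h' : IsSymbol n r m') :
    IsSymbol n r fun ξ => m ξ + m' ξ := by
  have key : ∀ {r : ℝ} {m m' : ℝ → ℂ},
      (∃ C, 0 ≤ C ∧ ∀ ξ : ℝ, 1 ≤ |ξ| → ‖m ξ‖ ≤ C * |ξ| ^ r) →
      (∃ C, 0 ≤ C ∧ ∀ ξ : ℝ, 1 ≤ |ξ| → ‖m' ξ‖ ≤ C * |ξ| ^ r) →
      ∃ C, ∀ ξ : ℝ, 1 ≤ |ξ| → ‖m ξ + m' ξ‖ ≤ C * |ξ| ^ r := by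
    rintro r m m' ⟨C, -, hC⟩ ⟨C', -, hC'⟩
    refine ⟨C + C', fun ξ hξ => (norm_add_le _ _).trans ?_⟩
    rw [add_mul]
    exact add_le_add (hC ξ hξ) (hC' ξ hξ)
  induction n generalizing r m m' with
  | zero => exact key h.bound h'.bound
  | succ n ih =>
    exact ⟨key h.bound h'.bound, fun ξ hξ => (h.2.1 ξ hξ).add (h'.2.1 ξ hξ),
      (ih h.2.2 h'.2.2).congr fun ξ hξ => deriv_add (h.2.1 ξ hξ) (h'.2.1 ξ hξ)⟩

theorem mul {n : ℕ} {r t : ℝ} {m m' : ℝ → ℂ} (h : IsSymbol n r m) (h' : IsSymbol n t m') :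
    IsSymbol n (r + t) fun ξ => m ξ * m' ξ := by
  have key : ∀ {r t : ℝ} {m m' : ℝ → ℂ},
      (∃ C, 0 ≤ C ∧ ∀ ξ : ℝ, 1 ≤ |ξ| → ‖m ξ‖ ≤ C * |ξ| ^ r) →
      (∃ C, 0 ≤ C ∧ ∀ ξ : ℝ, 1 ≤ |ξ| → ‖m' ξ‖ ≤ C * |ξ| ^ t) →
      ∃ C, ∀ ξ : ℝ, 1 ≤ |ξ| → ‖m ξ * m' ξ‖ ≤ C * |ξ| ^ (r + t) := by
    rintro r t m m' ⟨C, hC0, hC⟩ ⟨C', -, hC'⟩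
    refine ⟨C * C', fun ξ hξ => ?_⟩
    rw [norm_mul, Real.rpow_add (by linarith), mul_mul_mul_comm]
    exact mul_le_mul (hC ξ hξ) (hC' ξ hξ) (norm_nonneg _) (by positivity)
  induction n generalizing r t m m' with
  | zero => exact key h.bound h'.bound
  | succ n ih =>
    refine ⟨key h.bound h'.bound, fun ξ hξ => (h.2.1 ξ hξ).mul (h'.2.1 ξ hξ), ?_⟩
    have h1 := ih h.2.2 h'.of_succ
    have h2 := ih h.of_succ h'.2.2
    rw [show r - 1 + t = r + t - 1 by ring] at h1
    rw [show r + (t - 1) = r + t - 1 by ring] at h2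
    exact (h1.add h2).congr fun ξ hξ => deriv_mul (h.2.1 ξ hξ) (h'.2.1 ξ hξ)

/-- The reciprocal of an elliptic symbol of order `r` is a symbol of order `-r`: its derivative is
`-m' · m⁻¹ · m⁻¹`, to which the estimates for products apply inductively. -/
theorem inv {n : ℕ} {r : ℝ} {m : ℝ → ℂ} (h : IsSymbol n r m) (h0 : ∀ ξ, m ξ ≠ 0) {c : ℝ}
    (hc : 0 < c) (hm : ∀ ξ : ℝ, 1 ≤ |ξ| → c * |ξ| ^ r ≤ ‖m ξ‖) :
    IsSymbol n (-r) fun ξ => (m ξ)⁻¹ := by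
  have hb : ∃ C, ∀ ξ : ℝ, 1 ≤ |ξ| → ‖(m ξ)⁻¹‖ ≤ C * |ξ| ^ (-r) := by
    refine ⟨c⁻¹, fun ξ hξ => ?_⟩
    rw [norm_inv, Real.rpow_neg (abs_nonneg ξ), ← mul_inv]
    have : 0 < |ξ| := by linarith
    exact inv_anti₀ (by positivity) (hm ξ hξ)
  induction n with
  | zero => exact hb
  | succ n ih =>
    refine ⟨hb, fun ξ hξ => (h.2.1 ξ hξ).inv (h0 ξ), ?_⟩
    have hi := ih h.of_succ
    have h1 := ((const n (-1)).mul h.2.2).mul (hi.mul hi)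
    rw [show 0 + (r - 1) + (-r + -r) = -r - 1 by ring] at h1
    refine h1.congr fun ξ hξ => ?_
    have := ((h.2.1 ξ hξ).hasDerivAt.inv (h0 ξ)).deriv
    rw [show (fun ξ => (m ξ)⁻¹) = m⁻¹ from rfl, this]
    field_simp

theorem freq_cpow (n : ℕ) (s : ℝ) : IsSymbol n s fun ξ => freq ξ ^ (s : ℂ) := by
  have hb : ∀ s : ℝ, ∃ C, ∀ ξ : ℝ, 1 ≤ |ξ| → ‖freq ξ ^ (s : ℂ)‖ ≤ C * |ξ| ^ s := fun s =>
    ⟨(2 * Real.pi) ^ s, fun ξ _ => by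
      rw [norm_freq_cpow, norm_freq, Real.mul_rpow (by positivity) (abs_nonneg _)]⟩
  have hd : ∀ (s ξ : ℝ), ξ ≠ 0 → HasDerivAt (fun ξ => freq ξ ^ (s : ℂ))
      (s * freq ξ ^ ((s - 1 : ℝ) : ℂ) * (2 * Real.pi * Complex.I)) ξ := fun s ξ hξ => by
    have h1 : HasDerivAt freq (2 * Real.pi * Complex.I) ξ := by
      have := ((hasDerivAt_id ξ).ofReal_comp).const_mul (2 * Real.pi * Complex.I)
      rw [Complex.ofReal_one, mul_one] at this
      exact this
    have hs : freq ξ ∈ Complex.slitPlane :=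
      Or.inr (by rw [freq_im]; exact mul_ne_zero (by positivity) hξ)
    have := ((hasDerivAt_id (freq ξ)).cpow_const (c := (s : ℂ)) hs).comp ξ h1
    rw [mul_one] at this
    push_cast
    exact this
  induction n generalizing s with
  | zero => exact hb s
  | succ n ih =>
    refine ⟨hb s, fun ξ hξ => (hd s ξ hξ).differentiableAt, ?_⟩
    have := ((const n (s : ℂ)).mul (ih (s - 1))).mul (const n (2 * Real.pi * Complex.I))
    rw [zero_add, add_zero] at this
    exact this.congr fun ξ hξ => (hd s ξ hξ).deriv

theorem comp_neg {n : ℕ} {r : ℝ} {m : ℝ → ℂ} (h : IsSymbol n r m) :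
    IsSymbol n r fun ξ => m (-ξ) := by
  have key : ∀ {r : ℝ} {m : ℝ → ℂ}, (∃ C, 0 ≤ C ∧ ∀ ξ : ℝ, 1 ≤ |ξ| → ‖m ξ‖ ≤ C * |ξ| ^ r) →
      ∃ C, ∀ ξ : ℝ, 1 ≤ |ξ| → ‖m (-ξ)‖ ≤ C * |ξ| ^ r := by
    rintro r m ⟨C, -, hC⟩
    exact ⟨C, fun ξ hξ => by simpa using hC (-ξ) (by simpa using hξ)⟩
  induction n generalizing r m with
  | zero => exact key h.bound
  | succ n ih =>
    refine ⟨key h.bound, fun ξ hξ => ?_, ?_⟩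
    · exact (h.2.1 (-ξ) (neg_ne_zero.2 hξ)).comp ξ differentiableAt_id.neg
    · have := (const n (-1)).mul (ih h.2.2)
      rw [zero_add] at this
      refine this.congr fun ξ _ => ?_
      rw [deriv_comp_neg]
      ring

/-- A symbol of order `r` up to order `n` satisfies the derivative estimates in terms of
`iteratedDeriv`. -/
theorem iteratedDeriv {n : ℕ} {r : ℝ} {m : ℝ → ℂ} (h : IsSymbol n r m) :
    ∀ k ≤ n, IsSymbol (n - k) (r - k) (iteratedDeriv k m) := by
  induction n generalizing r m with
  | zero =>
    intro k hk
    obtain rfl : k = 0 := by omega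
    simpa using h
  | succ n ih =>
    intro k hk
    cases k with
    | zero => simpa using h
    | succ k =>
      have := ih h.2.2 k (by omega)
      rw [iteratedDeriv_succ', show n + 1 - (k + 1) = n - k by omega]
      convert this using 1
      push_cast
      ring

end IsSymbol

theorem isSymbol_opSymbol (n : ℕ) (p q a b : ℝ) {s : ℝ} (hs : 1 ≤ s) :
    IsSymbol n s (opSymbol p q a b s) := by
  have h1 := (IsSymbol.const n (p : ℂ)).mul (IsSymbol.freq_cpow n s)
  have h2 := (IsSymbol.const n (q : ℂ)).mul (IsSymbol.freq_cpow n s).comp_neg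
  have h3 := ((IsSymbol.const n (a : ℂ)).mul (IsSymbol.freq_cpow n 1)).mono
    (show 0 + 1 ≤ s by linarith)
  have h4 := (IsSymbol.const n (b : ℂ)).mono (show 0 ≤ s by linarith)
  rw [zero_add] at h1 h2
  refine (((h1.add h2).add h3).add h4).congr fun ξ _ => ?_
  have : freq (-ξ) = -freq ξ := by simp [freq]
  simp [opSymbol, this]

/-! ### Localizing the kernel -/

/-- Taylor's estimate along the segment from `ξ` to `ξ + h`, on either side of `ξ`. -/
theorem norm_sub_taylor_le {N : ℕ} {m : ℝ → ℂ} {ξ h C : ℝ}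
    (hd : ∀ k < N, ∀ t ∈ Set.uIcc 0 h, DifferentiableAt ℝ (iteratedDeriv k m) (ξ + t))
    (hC : ∀ t ∈ Set.uIcc 0 h, ‖iteratedDeriv N m (ξ + t)‖ ≤ C) :
    ‖m (ξ + h) - ∑ k ∈ Finset.range N, ((h ^ k / k.factorial : ℝ) : ℂ) * iteratedDeriv k m ξ‖
      ≤ C * |h| ^ N := by
  induction N generalizing m h with
  | zero => simpa using hC h Set.right_mem_uIcc
  | succ N ih =>
    set F : ℝ → ℂ := fun t => m (ξ + t) -
      ∑ k ∈ Finset.range (N + 1), ((t ^ k / k.factorial : ℝ) : ℂ) * iteratedDeriv k m ξ with hF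
    set F' : ℝ → ℂ := fun t => deriv m (ξ + t) -
      ∑ k ∈ Finset.range N, ((t ^ k / k.factorial : ℝ) : ℂ) * iteratedDeriv k (deriv m) ξ with hF'
    have hC0 : 0 ≤ C := (norm_nonneg _).trans (hC 0 Set.left_mem_uIcc)
    have hder : ∀ t ∈ Set.uIcc 0 h, HasDerivWithinAt F (F' t) (Set.uIcc 0 h) t := by
      intro t ht
      refine HasDerivAt.hasDerivWithinAt ?_
      have h1 : HasDerivAt (fun t => m (ξ + t)) (deriv m (ξ + t)) t := by
        have := hd 0 (by omega) t ht
        rw [iteratedDeriv_zero] at this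
        exact this.hasDerivAt.comp_const_add ξ t
      have h2 : HasDerivAt (fun t : ℝ => ∑ k ∈ Finset.range (N + 1),
          ((t ^ k / k.factorial : ℝ) : ℂ) * iteratedDeriv k m ξ)
          (∑ k ∈ Finset.range N, ((t ^ k / k.factorial : ℝ) : ℂ) * iteratedDeriv k (deriv m) ξ)
          t := by
        simp only [Finset.sum_range_succ']
        have h3 : HasDerivAt (fun t : ℝ => ∑ k ∈ Finset.range N,
            ((t ^ (k + 1) / (k + 1).factorial : ℝ) : ℂ) * iteratedDeriv (k + 1) m ξ)
            (∑ k ∈ Finset.range N, ((t ^ k / k.factorial : ℝ) : ℂ) * iteratedDeriv k (deriv m) ξ)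
            t := by
          refine HasDerivAt.fun_sum fun k _ => ?_
          rw [iteratedDeriv_succ']
          refine HasDerivAt.mul_const ?_ _
          have h4 : HasDerivAt (fun t : ℝ => t ^ (k + 1) / (k + 1).factorial)
              (t ^ k / k.factorial) t := by
            have := (hasDerivAt_pow (k + 1) t).div_const ((k + 1).factorial : ℝ)
            refine this.congr_deriv ?_
            rw [Nat.factorial_succ]
            push_cast
            have : (k.factorial : ℝ) ≠ 0 := by positivity
            field_simp
          exact h4.ofReal_comp
        simpa using h3.add_const (m ξ)
      exact h1.sub h2
    have hbd : ∀ t ∈ Set.uIcc 0 h, ‖F' t‖ ≤ C * |h| ^ N := by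
      intro t ht
      have hsub : Set.uIcc 0 t ⊆ Set.uIcc 0 h := Set.uIcc_subset_uIcc Set.left_mem_uIcc ht
      have := ih (m := deriv m) (h := t)
        (fun k hk y hy => by
          have := hd (k + 1) (by omega) y (hsub hy)
          rwa [iteratedDeriv_succ'] at this)
        (fun y hy => by
          have := hC y (hsub hy)
          rwa [iteratedDeriv_succ'] at this)
      refine this.trans ?_
      have hth : |t| ≤ |h| := by simpa using Set.abs_sub_left_of_mem_uIcc ht
      gcongr
    have hmv := Convex.norm_image_sub_le_of_norm_hasDerivWithin_le hder hbd
      (convex_uIcc 0 h) Set.left_mem_uIcc Set.right_mem_uIcc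
    have hF0 : F 0 = 0 := by
      simp [hF, Finset.sum_range_succ']
    rw [hF0, sub_zero, sub_zero, Real.norm_eq_abs, mul_assoc, ← pow_succ] at hmv
    exact hmv

/-- For a bounded symbol of order `0` the Taylor remainder at `ξ` gains the factor
`(|η| / |ξ|)^N`, uniformly in the increment `η`. -/
theorem exists_norm_sub_taylor_le {m : ℝ → ℂ} (hm : ∀ n, IsSymbol n 0 m) {B : ℝ}
    (hB : ∀ ξ, ‖m ξ‖ ≤ B) (N : ℕ) :
    ∃ C, 0 ≤ C ∧ ∀ ξ : ℝ, 2 ≤ |ξ| → ∀ η : ℝ,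
      ‖m (ξ - η) - ∑ k ∈ Finset.range N,
        (((-η) ^ k / k.factorial : ℝ) : ℂ) * iteratedDeriv k m ξ‖ ≤ C * |η| ^ N / |ξ| ^ N := by
  have hex : ∀ k, ∃ A, 0 ≤ A ∧ ∀ ξ : ℝ, 1 ≤ |ξ| → ‖iteratedDeriv k m ξ‖ ≤ A / |ξ| ^ k := by
    intro k
    obtain ⟨A, hA0, hA⟩ := ((hm k).iteratedDeriv k le_rfl).bound
    refine ⟨A, hA0, fun ξ hξ => ?_⟩
    have := hA ξ hξ
    rwa [zero_sub, Real.rpow_neg (abs_nonneg _), Real.rpow_natCast, ← div_eq_mul_inv] at this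
  choose A hA0 hA using hex
  have hdiff : ∀ k x, x ≠ 0 → DifferentiableAt ℝ (iteratedDeriv k m) x := fun k x hx => by
    have := (hm (k + 1)).iteratedDeriv k (by omega)
    rw [show k + 1 - k = 0 + 1 by omega] at this
    exact this.2.1 x hx
  have hB0 : 0 ≤ B := (norm_nonneg _).trans (hB 0)
  set S := ∑ k ∈ Finset.range N, A k with hS
  have hS0 : 0 ≤ S := Finset.sum_nonneg fun k _ => hA0 k
  refine ⟨(A N + (B + S)) * 2 ^ N, by have := hA0 N; positivity, fun ξ hξ η => ?_⟩
  have hξ0 : 0 < |ξ| := by linarith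
  -- For `|η| ≤ |ξ| / 2` the segment stays away from the origin; otherwise each term of the
  -- remainder is bounded separately by a power of `2 |η| / |ξ| ≥ 1`.
  rcases le_total |η| (|ξ| / 2) with h | h
  · have hseg : ∀ t ∈ Set.uIcc 0 (-η), |ξ| / 2 ≤ |ξ + t| := by
      intro t ht
      have h1 : |t| ≤ |η| := by simpa using Set.abs_sub_left_of_mem_uIcc ht
      have h2 := abs_sub_abs_le_abs_sub ξ (-t)
      rw [abs_neg, sub_neg_eq_add] at h2
      linarith
    have := norm_sub_taylor_le (N := N) (m := m) (ξ := ξ) (h := -η) (C := A N / (|ξ| / 2) ^ N)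
      (fun k _ t ht => hdiff k _ (abs_pos.1 (by have := hseg t ht; linarith)))
      (fun t ht => (hA N _ (by have := hseg t ht; linarith)).trans (by
        have := hseg t ht
        have := hA0 N
        gcongr))
    rw [← sub_eq_add_neg, abs_neg] at this
    refine this.trans ?_
    rw [div_pow, div_div_eq_mul_div, div_mul_eq_mul_div]
    have := hA0 N
    gcongr
    linarith
  · have hq : 1 ≤ 2 * |η| / |ξ| := by rw [le_div_iff₀ hξ0]; linarith
    set Q := 2 * |η| / |ξ| with hQ
    have h1 : ‖m (ξ - η)‖ ≤ B * Q ^ N :=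
      (hB _).trans (le_mul_of_one_le_right hB0 (one_le_pow₀ hq))
    have h2 : ‖∑ k ∈ Finset.range N,
        (((-η) ^ k / k.factorial : ℝ) : ℂ) * iteratedDeriv k m ξ‖ ≤ S * Q ^ N := by
      rw [hS, Finset.sum_mul]
      refine norm_sum_le_of_le _ fun k hk => ?_
      rw [norm_mul, Complex.norm_real, Real.norm_eq_abs, abs_div, abs_pow, abs_neg,
        Nat.abs_cast]
      have hk1 : (1 : ℝ) ≤ k.factorial := by
        exact_mod_cast Nat.one_le_iff_ne_zero.2 k.factorial_ne_zero
      calc |η| ^ k / k.factorial * ‖iteratedDeriv k m ξ‖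
          ≤ |η| ^ k / 1 * (A k / |ξ| ^ k) := by
            gcongr
            exact hA k ξ (by linarith)
        _ = A k * (|η| / |ξ|) ^ k := by rw [div_pow]; ring
        _ ≤ A k * Q ^ k := by
            have := hA0 k
            rw [hQ]
            gcongr
            linarith [abs_nonneg η]
        _ ≤ A k * Q ^ N := by
            have := hA0 k
            gcongr
            exact (Finset.mem_range.1 hk).le
    calc _ ≤ B * Q ^ N + S * Q ^ N := (norm_sub_le _ _).trans (add_le_add h1 h2)
      _ = (B + S) * 2 ^ N * |η| ^ N / |ξ| ^ N := by
          rw [hQ, div_pow, mul_pow]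
          ring
      _ ≤ _ := by
          have : B + S ≤ A N + (B + S) := by linarith [hA0 N]
          generalize B + S = T at *
          gcongr

open Filter Topology in
/-- The transform of a Schwartz function that equals `1` near the origin has total integral `1`, and
its higher moments vanish. -/
theorem integral_pow_mul_fourier_of_eq_one {φ : SchwartzMap ℝ ℂ} (hφ : ∀ᶠ x in 𝓝 0, φ x = 1)
    (k : ℕ) : ∫ η : ℝ, (η : ℂ) ^ k * 𝓕 (φ : ℝ → ℂ) η = if k = 0 then 1 else 0 := by
  have h1 : 𝓕 (𝓕 (φ : ℝ → ℂ)) =ᶠ[𝓝 0] fun _ => (1 : ℂ) := by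
    have ht : Tendsto (fun x : ℝ => -x) (𝓝 0) (𝓝 0) := by
      simpa using (continuous_neg.tendsto (0 : ℝ))
    filter_upwards [ht.eventually hφ] with x hx
    rw [← hx, ← neg_neg x, ← Real.fourierInv_eq_fourier_neg, neg_neg, ← SchwartzMap.fourier_coe,
      ← SchwartzMap.fourierInv_coe, FourierTransform.fourierInv_fourier_eq]
  have hint : ∀ n : ℕ, Integrable fun η : ℝ => η ^ n • (𝓕 φ) η := by
    intro n
    refine ((𝓕 φ).integrable_pow_mul volume n).mono' ?_ (ae_of_all _ fun η => ?_)
    · exact ((continuous_pow n).smul (𝓕 φ).continuous).aestronglyMeasurable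
    · rw [norm_smul, norm_pow]
  have h2 := Real.iteratedDeriv_fourier (N := ⊤) (n := k) (f := 𝓕 (φ : ℝ → ℂ))
    (fun n _ => hint n) le_top
  have h3 := (h1.iteratedDeriv_eq k)
  rw [h2, fourier_eq_integral_freq] at h3
  have h4 : ∀ η : ℝ, Complex.exp (-(freq η * (0 : ℝ))) *
      ((-2 * Real.pi * Complex.I * η) ^ k • 𝓕 (φ : ℝ → ℂ) η)
      = (-2 * Real.pi * Complex.I) ^ k * ((η : ℂ) ^ k * 𝓕 (φ : ℝ → ℂ) η) := fun η => by
    simp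
    ring
  simp only [h4] at h3
  rw [integral_const_mul] at h3
  have h5 : (-2 * Real.pi * Complex.I : ℂ) ^ k ≠ 0 := by
    apply pow_ne_zero
    simp [Real.pi_ne_zero]
  refine mul_left_cancel₀ h5 (h3.trans ?_)
  rw [iteratedDeriv_const]
  split_ifs with hk
  · simp [hk]
  · simp

theorem integral_fourierInv_mul_flip {f g : ℝ → ℂ} (hf : Integrable f) (hg : Integrable g) :
    ∫ ξ, 𝓕⁻ f ξ * g ξ = ∫ x, f x * 𝓕⁻ g x := by
  have h1 := integral_fourier_mul_flip hf hg.comp_neg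
  rw [← integral_neg_eq_self (fun ξ => 𝓕⁻ f ξ * g ξ) volume]
  simp only [Real.fourierInv_eq_fourier_neg, neg_neg]
  rw [h1]
  refine integral_congr_ae (ae_of_all _ fun x => ?_)
  dsimp only
  rw [← Real.fourierInv_eq_fourier_neg, Real.fourierInv_eq_fourier_comp_neg]

/-- Cutting off `𝓕⁻ m` by `φ` convolves `m` with the transform of `φ`. -/
theorem fourier_mul_fourierInv {m : ℝ → ℂ} (hm : Integrable m) (φ : SchwartzMap ℝ ℂ) (ξ : ℝ) :
    𝓕 (fun x => φ x * 𝓕⁻ m x) ξ = ∫ η, m (ξ - η) * 𝓕 (φ : ℝ → ℂ) η := by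
  have hc : Continuous fun x : ℝ => Complex.exp (-(freq x * ξ)) := by
    have := continuous_freq
    fun_prop
  have hg : Integrable fun x : ℝ => Complex.exp (-(freq x * ξ)) * φ x :=
    φ.integrable.bdd_mul (c := 1) hc.aestronglyMeasurable
      (ae_of_all _ fun x => (norm_exp_neg_freq_mul _ _).le)
  rw [fourier_eq_integral_freq]
  calc _ = ∫ x, 𝓕⁻ m x * (Complex.exp (-(freq x * ξ)) * φ x) :=
        integral_congr_ae (ae_of_all _ fun x => by dsimp only; ring)
    _ = ∫ η, m η * 𝓕⁻ (fun x : ℝ => Complex.exp (-(freq x * ξ)) * φ x) η :=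
        integral_fourierInv_mul_flip hm hg
    _ = ∫ η, m η * 𝓕 (φ : ℝ → ℂ) (ξ - η) := by
        refine integral_congr_ae (ae_of_all _ fun η => ?_)
        dsimp only
        rw [Real.fourierInv_eq_fourier_neg, fourier_eq_integral_freq, fourier_eq_integral_freq]
        congr 1
        refine integral_congr_ae (ae_of_all _ fun x => ?_)
        dsimp only
        rw [← mul_assoc, ← Complex.exp_add]
        congr 2
        push_cast
        ring
    _ = _ := by
        rw [← integral_sub_left_eq_self (fun η => m η * 𝓕 (φ : ℝ → ℂ) (ξ - η)) volume ξ]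
        simp only [sub_sub_cancel]

open Filter Topology in
/-- Cutting off the kernel `𝓕⁻ m` away from the origin leaves a transform of rapid decay: the Taylor
polynomials of `m` are reproduced by `φ`, and the remainders decay. -/
theorem exists_norm_sub_fourier_mul_fourierInv_le {m : ℝ → ℂ} (hm : ∀ n, IsSymbol n 0 m) {B : ℝ}
    (hB : ∀ ξ, ‖m ξ‖ ≤ B) (hi : Integrable m) (hc : Continuous m) {φ : SchwartzMap ℝ ℂ}
    (hφ : ∀ᶠ x in 𝓝 0, φ x = 1) (N : ℕ) :
    ∃ C, 0 ≤ C ∧ ∀ ξ : ℝ, 2 ≤ |ξ| → ‖m ξ - 𝓕 (fun x => φ x * 𝓕⁻ m x) ξ‖ ≤ C / |ξ| ^ N := by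
  obtain ⟨C, hC0, hC⟩ := exists_norm_sub_taylor_le hm hB (N + 1)
  have hpow : ∀ n : ℕ, Integrable fun η : ℝ => |η| ^ n * ‖(𝓕 φ) η‖ := fun n => by
    simpa using (𝓕 φ).integrable_pow_mul volume n
  have hmom : ∀ n : ℕ, Integrable fun η : ℝ => (η : ℂ) ^ n * (𝓕 φ) η := by
    intro n
    refine (hpow n).mono' ?_ (ae_of_all _ fun η => ?_)
    · exact ((Complex.continuous_ofReal.pow n).mul (𝓕 φ).continuous).aestronglyMeasurable
    · simp
  refine ⟨C * ∫ η : ℝ, |η| ^ (N + 1) * ‖(𝓕 φ) η‖, by positivity, fun ξ hξ => ?_⟩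
  have hξ0 : 0 < |ξ| := by linarith
  have hterm : ∀ k : ℕ, ∀ η : ℝ, (((-η) ^ k / k.factorial : ℝ) : ℂ) * iteratedDeriv k m ξ * (𝓕 φ) η
      = ((-1) ^ k / k.factorial * iteratedDeriv k m ξ) * ((η : ℂ) ^ k * (𝓕 φ) η) := fun k η => by
    push_cast
    rw [neg_pow (η : ℂ)]
    ring
  have hint1 : Integrable fun η => m (ξ - η) * (𝓕 φ) η :=
    (𝓕 φ).integrable.bdd_mul (c := B) (by fun_prop) (ae_of_all _ fun η => hB _)
  have hint2 : ∀ k ∈ Finset.range (N + 1), Integrable fun η : ℝ =>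
      (((-η) ^ k / k.factorial : ℝ) : ℂ) * iteratedDeriv k m ξ * (𝓕 φ) η := fun k _ => by
    simp only [hterm]
    exact (hmom k).const_mul _
  have hpoly : ∫ η : ℝ, ∑ k ∈ Finset.range (N + 1),
      (((-η) ^ k / k.factorial : ℝ) : ℂ) * iteratedDeriv k m ξ * (𝓕 φ) η = m ξ := by
    have hk : ∀ k : ℕ,
        ∫ η : ℝ, (((-η) ^ k / k.factorial : ℝ) : ℂ) * iteratedDeriv k m ξ * (𝓕 φ) η
          = ((-1) ^ k / k.factorial * iteratedDeriv k m ξ) * (if k = 0 then 1 else 0) := fun k => by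
      rw [integral_congr_ae (ae_of_all _ (hterm k)), integral_const_mul, SchwartzMap.fourier_coe,
        integral_pow_mul_fourier_of_eq_one hφ]
    rw [integral_finsetSum _ hint2, Finset.sum_congr rfl fun k _ => hk k]
    simp
  have hdiff : (∫ η, m (ξ - η) * (𝓕 φ) η) - m ξ
      = ∫ η, (m (ξ - η) * (𝓕 φ) η - ∑ k ∈ Finset.range (N + 1),
        (((-η) ^ k / k.factorial : ℝ) : ℂ) * iteratedDeriv k m ξ * (𝓕 φ) η) := by
    rw [integral_sub hint1 (integrable_finsetSum _ hint2), hpoly]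
  rw [norm_sub_rev, fourier_mul_fourierInv hi, ← SchwartzMap.fourier_coe, hdiff]
  have hb : ∀ η, ‖m (ξ - η) * (𝓕 φ) η - ∑ k ∈ Finset.range (N + 1),
      (((-η) ^ k / k.factorial : ℝ) : ℂ) * iteratedDeriv k m ξ * (𝓕 φ) η‖
      ≤ C / |ξ| ^ (N + 1) * (|η| ^ (N + 1) * ‖(𝓕 φ) η‖) := fun η => by
    rw [← Finset.sum_mul, ← sub_mul, norm_mul]
    calc _ ≤ C * |η| ^ (N + 1) / |ξ| ^ (N + 1) * ‖(𝓕 φ) η‖ := by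
          gcongr
          exact hC ξ hξ η
      _ = _ := by ring
  refine (norm_integral_le_of_norm_le ((hpow (N + 1)).const_mul _) (ae_of_all _ hb)).trans ?_
  rw [integral_const_mul, div_mul_eq_mul_div]
  have : 0 ≤ ∫ η : ℝ, |η| ^ (N + 1) * ‖(𝓕 φ) η‖ := by positivity
  gcongr
  · linarith
  · omega

/-! ### Smoothness of the inverse transform -/

theorem memLp_inv_one_add_norm : MemLp (fun ξ : ℝ => (1 + ‖ξ‖)⁻¹) 2 volume := by
  have hm : AEStronglyMeasurable (fun ξ : ℝ => (1 + ‖ξ‖)⁻¹) volume :=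
    Measurable.aestronglyMeasurable (by fun_prop)
  rw [memLp_two_iff_integrable_sq_norm hm]
  have := integrable_one_add_norm (E := ℝ) (μ := volume) (r := 2) (by simp)
  refine this.congr (ae_of_all _ fun ξ => ?_)
  dsimp only
  rw [Real.rpow_neg (by positivity), Real.rpow_two, norm_inv,
    Real.norm_of_nonneg (show 0 ≤ 1 + ‖ξ‖ by positivity), inv_pow]

theorem Lp_fourierInv_ae_eq_fourier_neg {W : Lp ℂ 2 (volume : Measure ℝ)} (hW : Integrable W) :
    (𝓕⁻ W : Lp ℂ 2 (volume : Measure ℝ)) =ᵐ[volume] fun x => 𝓕 (W : ℝ → ℂ) (-x) := by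
  refine ae_eq_of_forall_test (Lp.locallyIntegrable_coeFn _)
    ((continuous_fourier_of_integrable hW).comp continuous_neg).locallyIntegrable fun ψ hψ => ?_
  rw [integral_Lp_fourierInv_mul, SchwartzMap.fourierInv_coe,
    ← integral_fourierInv_mul_flip hW hψ.schwartz.integrable]
  simp only [Real.fourierInv_eq_fourier_neg]

/-- If `R` decays rapidly, then `𝓕⁻ (R g)` is smooth for every `g ∈ L²`. -/
theorem exists_contDiff_fourierInv_of_decay {R : ℝ → ℂ} {B : ℝ} (hB : ∀ ξ, ‖R ξ‖ ≤ B)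
    (hR : ∀ N : ℕ, ∃ C, 0 ≤ C ∧ ∀ ξ : ℝ, 2 ≤ |ξ| → ‖R ξ‖ ≤ C / |ξ| ^ N)
    {g W : Lp ℂ 2 (volume : Measure ℝ)} (hW : W =ᵐ[volume] fun ξ => R ξ * g ξ) :
    ∃ h : ℝ → ℂ, ContDiff ℝ ∞ h ∧ (𝓕⁻ W : Lp ℂ 2 (volume : Measure ℝ)) =ᵐ[volume] h := by
  have hB0 : 0 ≤ B := (norm_nonneg _).trans (hB 0)
  have hint : ∀ n : ℕ, Integrable fun ξ : ℝ => ξ ^ n • W ξ := by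
    intro n
    obtain ⟨C, hC0, hC⟩ := hR (n + 1)
    have hprod : Integrable fun ξ : ℝ => (1 + ‖ξ‖)⁻¹ * ‖g ξ‖ :=
      memLp_inv_one_add_norm.integrable_mul (Lp.memLp g).norm
    refine (hprod.const_mul (2 * C + 3 * 2 ^ n * B)).mono'
      ((continuous_pow n).aestronglyMeasurable.smul (Lp.memLp W).1) ?_
    filter_upwards [hW] with ξ hξ
    rw [norm_smul, hξ, norm_mul, norm_pow, ← mul_assoc, ← mul_assoc, Real.norm_eq_abs]
    refine mul_le_mul_of_nonneg_right ?_ (norm_nonneg _)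
    rw [← div_eq_mul_inv, le_div_iff₀ (by positivity)]
    have hBn : 0 ≤ 2 ^ n * B := by positivity
    rcases le_total 2 |ξ| with h | h
    · have hξ0 : 0 < |ξ| := by linarith
      calc _ ≤ |ξ| ^ n * (C / |ξ| ^ (n + 1)) * (2 * |ξ|) := by
            gcongr
            · exact hC ξ h
            · linarith
        _ = 2 * C := by
            field_simp
            ring
        _ ≤ _ := by linarith
    · calc _ ≤ 2 ^ n * B * 3 := by
            gcongr
            · exact hB ξ
            · linarith
        _ ≤ _ := by linarith
  have hW1 : Integrable W := by simpa using hint 0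
  refine ⟨fun x => 𝓕 (W : ℝ → ℂ) (-x), ?_, Lp_fourierInv_ae_eq_fourier_neg hW1⟩
  have h1 : ContDiff ℝ ∞ (𝓕 (W : ℝ → ℂ)) := Real.contDiff_fourier (N := ⊤) fun n _ => by
    simpa [norm_smul] using (hint n).norm
  exact h1.comp contDiff_neg

/-- Convolution of a compactly supported continuous kernel with a smooth function; no support
condition is imposed on `f`, but only its values in a bounded set enter at each point. -/
theorem contDiff_integral_mul_comp_sub {κ : ℝ → ℂ} (hκ : Continuous κ) (hs : HasCompactSupport κ)
    {f : ℝ → ℝ} (hf : ContDiff ℝ ∞ f) : ContDiff ℝ ∞ fun x => ∫ t, κ t * (f (x - t) : ℂ) := by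
  obtain ⟨r, hr0, hr⟩ := hs.isCompact.isBounded.subset_closedBall_lt 0 (0 : ℝ)
  let χ : ContDiffBump (0 : ℝ) := ⟨r, r + 1, hr0, by linarith⟩
  have hfC : ContDiff ℝ ∞ fun x => (f x : ℂ) := Complex.ofRealCLM.contDiff.comp hf
  have hχC : ContDiff ℝ ∞ fun x => (χ x : ℂ) := Complex.ofRealCLM.contDiff.comp χ.contDiff
  -- The value at `0` of a convolution whose second factor depends on the parameter `x`; there the
  -- cutoff makes its support compact, uniformly in `x`.
  have h := contDiffOn_convolution_right_with_param_comp (μ := volume) (n := ⊤)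
    (ContinuousLinearMap.mul ℝ ℂ) (P := ℝ) (v := fun _ => (0 : ℝ)) (s := Set.univ)
    (f := κ) (g := fun x y => (χ y : ℂ) * (f (x + y) : ℂ)) (k := tsupport χ)
    contDiffOn_const isOpen_univ χ.hasCompactSupport
    (fun x y _ hy => by simp [image_eq_zero_of_notMem_tsupport hy])
    hκ.locallyIntegrable
    ((hχC.comp contDiff_snd).mul (hfC.comp (contDiff_fst.add contDiff_snd))).contDiffOn
  have hconv := contDiffOn_univ.1 h
  convert hconv using 2 with x
  rw [convolution_def]
  refine integral_congr_ae (ae_of_all _ fun t => ?_)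
  rcases eq_or_ne (κ t) 0 with h0 | h0
  · simp [h0]
  · have ht : -t ∈ Metric.closedBall (0 : ℝ) χ.rIn := by
      have := hr (subset_tsupport κ h0)
      simpa using this
    simp [χ.one_of_mem_closedBall ht, sub_eq_add_neg]

/-- Multiplying by `𝓕 κ` on the Fourier side is convolution with `κ`, which preserves smoothness
when `κ` has compact support. -/
theorem exists_contDiff_fourierInv_of_hasCompactSupport {κ : ℝ → ℂ} (hκ : Continuous κ)
    (hs : HasCompactSupport κ) {f : ℝ → ℝ} (hf : MemLp f 2 volume) (hfs : ContDiff ℝ ∞ f)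
    {W : Lp ℂ 2 (volume : Measure ℝ)} (hW : W =ᵐ[volume] fun ξ => 𝓕 κ ξ * plancherel hf ξ) :
    ∃ h : ℝ → ℂ, ContDiff ℝ ∞ h ∧ (𝓕⁻ W : Lp ℂ 2 (volume : Measure ℝ)) =ᵐ[volume] h := by
  have hκi : Integrable κ := hκ.integrable_of_hasCompactSupport hs
  have hκc := continuous_fourier_of_integrable hκi
  have hh := contDiff_integral_mul_comp_sub hκ hs hfs
  refine ⟨_, hh, ae_eq_of_forall_test (Lp.locallyIntegrable_coeFn _)
    hh.continuous.locallyIntegrable fun ψ hψ => ?_⟩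
  set θ : SchwartzMap ℝ ℂ := 𝓕⁻ hψ.schwartz with hθ
  have hψc : Continuous ψ := hψ.1.continuous
  have hfc : Continuous f := hfs.continuous
  -- The transform of `𝓕 κ * θ` is a correlation of `κ` with `ψ`.
  have hcorr : ∀ y, 𝓕 (fun ξ => 𝓕 κ ξ * θ ξ) y = ∫ t, κ t * (ψ (t + y) : ℂ) := by
    intro y
    have hc : Continuous fun x : ℝ => Complex.exp (-(freq x * y)) := by
      have := continuous_freq
      fun_prop
    have hg : Integrable fun x : ℝ => Complex.exp (-(freq x * y)) * θ x :=
      θ.integrable.bdd_mul (c := 1) hc.aestronglyMeasurable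
        (ae_of_all _ fun x => (norm_exp_neg_freq_mul _ _).le)
    rw [fourier_eq_integral_freq]
    calc _ = ∫ ξ, 𝓕 κ ξ * (Complex.exp (-(freq ξ * y)) * θ ξ) :=
          integral_congr_ae (ae_of_all _ fun x => by dsimp only; ring)
      _ = ∫ t, κ t * 𝓕 (fun ξ : ℝ => Complex.exp (-(freq ξ * y)) * θ ξ) t :=
          integral_fourier_mul_flip hκi hg
      _ = _ := by
          refine integral_congr_ae (ae_of_all _ fun t => ?_)
          dsimp only
          have h1 := congrFun hψ.fourier_fourierInv (t + y)
          rw [← h1, fourier_eq_integral_freq, fourier_eq_integral_freq]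
          congr 1
          refine integral_congr_ae (ae_of_all _ fun x => ?_)
          dsimp only
          rw [← mul_assoc, ← Complex.exp_add]
          congr 2
          push_cast
          ring
  have hi1 : Integrable fun ξ => 𝓕 κ ξ * θ ξ :=
    θ.integrable.bdd_mul hκc.aestronglyMeasurable (ae_of_all _ fun ξ => norm_fourier_le κ ξ)
  obtain ⟨C0, -, h0⟩ := θ.decay 0 0
  have hi2 : MemLp (fun ξ => 𝓕 κ ξ * θ ξ) 2 volume :=
    hi1.memLp_two_of_bound (C := (∫ x, ‖κ x‖) * C0) fun ξ => by
      have h0' : ‖θ ξ‖ ≤ C0 := by simpa using h0 ξ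
      rw [norm_mul]
      gcongr
      exact norm_fourier_le κ ξ
  have hcoe : (hf.ofReal.toLp (fun x => (f x : ℂ)) : ℝ → ℂ) =ᵐ[volume] fun x => (f x : ℂ) :=
    MemLp.coeFn_toLp _
  calc _ = ∫ ξ, W ξ * θ ξ := integral_Lp_fourierInv_mul W _
    _ = ∫ ξ, plancherel hf ξ * (𝓕 κ ξ * θ ξ) := by
        refine integral_congr_ae ?_
        filter_upwards [hW] with ξ hξ
        rw [hξ]
        ring
    _ = ∫ y, (hf.ofReal.toLp (fun x => (f x : ℂ))) y * 𝓕 (fun ξ => 𝓕 κ ξ * θ ξ) y :=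
        (integral_mul_fourier _ hi1 hi2).symm
    _ = ∫ y, ∫ t, (f y : ℂ) * (κ t * (ψ (t + y) : ℂ)) := by
        refine integral_congr_ae ?_
        filter_upwards [hcoe] with y hy
        rw [hy, hcorr, integral_const_mul]
    _ = ∫ t, ∫ y, (f y : ℂ) * (κ t * (ψ (t + y) : ℂ)) := by
        refine integral_integral_swap_of_hasCompactSupport (by fun_prop) ?_
        have hK : IsCompact ((fun z : ℝ × ℝ => (z.2 - z.1, z.1)) '' (tsupport κ ×ˢ tsupport ψ)) :=
          (hs.isCompact.prod hψ.2.isCompact).image (by fun_prop)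
        refine HasCompactSupport.intro hK fun z hz => ?_
        by_contra hne
        simp only [Function.uncurry, mul_eq_zero, not_or, Complex.ofReal_eq_zero] at hne
        exact hz ⟨(z.2, z.2 + z.1), ⟨subset_tsupport _ hne.2.1, subset_tsupport _ hne.2.2⟩,
          by simp⟩
    _ = ∫ t, ∫ x, κ t * (f (x - t) : ℂ) * (ψ x : ℂ) := by
        refine integral_congr_ae (ae_of_all _ fun t => ?_)
        dsimp only
        rw [← integral_add_right_eq_self (fun x => κ t * (f (x - t) : ℂ) * (ψ x : ℂ)) t]
        refine integral_congr_ae (ae_of_all _ fun y => ?_)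
        dsimp only
        rw [add_sub_cancel_right, add_comm y t]
        ring
    _ = ∫ x, ∫ t, κ t * (f (x - t) : ℂ) * (ψ x : ℂ) := by
        refine integral_integral_swap_of_hasCompactSupport (by fun_prop) ?_
        refine HasCompactSupport.intro (hs.isCompact.prod hψ.2.isCompact) fun z hz => ?_
        by_contra hne
        simp only [Function.uncurry, mul_eq_zero, not_or, Complex.ofReal_eq_zero] at hne
        exact hz ⟨subset_tsupport _ hne.1.1, subset_tsupport _ hne.2⟩
    _ = _ := by
        refine integral_congr_ae (ae_of_all _ fun x => ?_)
        dsimp only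
        rw [integral_mul_const, hψ.schwartz_apply]

/-- A multiplier that is an integrable symbol of order `0` preserves smoothness of functions in
`L²`: the part of its kernel near the origin acts by convolution with a compactly supported
continuous function, and the rest has a rapidly decaying transform. -/
theorem exists_contDiff_fourierInv_of_isSymbol {m : ℝ → ℂ} (hm : ∀ n, IsSymbol n 0 m) {B : ℝ}
    (hB : ∀ ξ, ‖m ξ‖ ≤ B) (hi : Integrable m) (hc : Continuous m) {f : ℝ → ℝ}
    (hf : MemLp f 2 volume) (hfs : ContDiff ℝ ∞ f) {W : Lp ℂ 2 (volume : Measure ℝ)}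
    (hW : W =ᵐ[volume] fun ξ => m ξ * plancherel hf ξ) :
    ∃ h : ℝ → ℂ, ContDiff ℝ ∞ h ∧ (𝓕⁻ W : Lp ℂ 2 (volume : Measure ℝ)) =ᵐ[volume] h := by
  let χ : ContDiffBump (0 : ℝ) := ⟨1, 2, one_pos, one_lt_two⟩
  have hχ : IsTestFunction χ := ⟨χ.contDiff, χ.hasCompactSupport⟩
  have hφ : ∀ᶠ x in nhds 0, hχ.schwartz x = 1 := by
    filter_upwards [χ.eventuallyEq_one] with x hx
    rw [hχ.schwartz_apply, hx]
    simp
  have hk : Continuous (𝓕⁻ m) := by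
    have : 𝓕⁻ m = fun x => 𝓕 m (-x) := funext fun x => Real.fourierInv_eq_fourier_neg m x
    rw [this]
    exact (continuous_fourier_of_integrable hi).comp continuous_neg
  set κ : ℝ → ℂ := fun x => hχ.schwartz x * 𝓕⁻ m x with hκd
  have hκ : Continuous κ := hχ.schwartz.continuous.mul hk
  have hκs : HasCompactSupport κ :=
    (hχ.2.comp_left (g := Complex.ofReal) Complex.ofReal_zero).mul_right
  have hκi : Integrable κ := hκ.integrable_of_hasCompactSupport hκs
  have hmem : MemLp (fun ξ => 𝓕 κ ξ * plancherel hf ξ) 2 volume := by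
    refine (Lp.memLp (plancherel hf)).of_le_mul (c := ∫ x, ‖κ x‖)
      ((continuous_fourier_of_integrable hκi).aestronglyMeasurable.mul (Lp.memLp _).1)
      (ae_of_all _ fun ξ => ?_)
    rw [norm_mul]
    gcongr
    exact norm_fourier_le κ ξ
  obtain ⟨h1, hh1, he1⟩ := exists_contDiff_fourierInv_of_hasCompactSupport hκ hκs hf hfs
    hmem.coeFn_toLp
  have hrest : (W - hmem.toLp _ : Lp ℂ 2 (volume : Measure ℝ))
      =ᵐ[volume] fun ξ => (m ξ - 𝓕 κ ξ) * plancherel hf ξ := by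
    filter_upwards [Lp.coeFn_sub W (hmem.toLp _), hW, hmem.coeFn_toLp] with ξ h1 h2 h3
    rw [h1, Pi.sub_apply, h2, h3, sub_mul]
  obtain ⟨h2, hh2, he2⟩ := exists_contDiff_fourierInv_of_decay (B := B + ∫ x, ‖κ x‖)
    (fun ξ => (norm_sub_le _ _).trans (add_le_add (hB ξ) (norm_fourier_le κ ξ)))
    (fun N => exists_norm_sub_fourier_mul_fourierInv_le hm hB hi hc hφ N) hrest
  refine ⟨fun x => h1 x + h2 x, hh1.add hh2, ?_⟩
  have hsum : (𝓕⁻ W : Lp ℂ 2 (volume : Measure ℝ)) = 𝓕⁻ (hmem.toLp _) + 𝓕⁻ (W - hmem.toLp _) := by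
    rw [← FourierTransform.fourierInv_add, add_sub_cancel]
  rw [hsum]
  filter_upwards [Lp.coeFn_add (𝓕⁻ (hmem.toLp _) : Lp ℂ 2 (volume : Measure ℝ))
    (𝓕⁻ (W - hmem.toLp _)), he1, he2] with x h h' h''
  rw [h, Pi.add_apply, h', h'']

/-! ### The inverse of the symbol -/

theorem continuous_opSymbol (p q a b : ℝ) {s : ℝ} (hs : 0 < s) :
    Continuous (opSymbol p q a b s) := by
  have h1 := continuous_freq
  have h2 : Continuous fun ξ => freq ξ ^ (s : ℂ) := continuous_iff_continuousAt.2 fun ξ =>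
    ContinuousAt.comp (g := fun z : ℂ => z ^ (s : ℂ))
      (Complex.continuousAt_cpow_const_of_re_pos (Or.inl (freq_re ξ).ge) (by simpa)) h1.continuousAt
  have h3 : Continuous fun ξ => (-freq ξ) ^ (s : ℂ) := continuous_iff_continuousAt.2 fun ξ =>
    ContinuousAt.comp (g := fun z : ℂ => z ^ (s : ℂ))
      (Complex.continuousAt_cpow_const_of_re_pos (Or.inl (by simp [freq_re])) (by simpa))
      h1.neg.continuousAt
  unfold opSymbol
  fun_prop

open ComplexConjugate in
theorem opSymbol_neg (p q a b s ξ : ℝ) :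
    opSymbol p q a b s (-ξ) = conj (opSymbol p q a b s ξ) := by
  have h1 : freq (-ξ) = conj (freq ξ) := by simp [freq, map_ofNat]
  have h2 : conj (freq ξ ^ (s : ℂ)) = conj (freq ξ) ^ (s : ℂ) := by
    rw [Complex.conj_cpow _ _ fun h => by simpa [freq_re] using (Complex.arg_eq_pi_iff.1 h).1,
      Complex.conj_ofReal]
  have h3 : conj ((-freq ξ) ^ (s : ℂ)) = (-conj (freq ξ)) ^ (s : ℂ) := by
    rw [← map_neg,
      Complex.conj_cpow _ _ fun h => by simpa [freq_re] using (Complex.arg_eq_pi_iff.1 h).1,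
      Complex.conj_ofReal]
  simp only [opSymbol, map_add, map_mul, Complex.conj_ofReal, h1, h2, h3]

theorem one_add_abs_rpow_le {s : ℝ} (hs : 1 ≤ s) (ξ : ℝ) :
    (1 + |ξ|) ^ s ≤ 2 ^ (s - 1) * (1 + ‖freq ξ‖ ^ s) := by
  have h1 : |ξ| ≤ ‖freq ξ‖ := by
    rw [norm_freq]
    exact le_mul_of_one_le_left (abs_nonneg _) (by linarith [Real.pi_gt_three])
  have h2 : (1 + |ξ|) ^ s ≤ 2 ^ (s - 1) * (1 ^ s + |ξ| ^ s) := by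
    exact_mod_cast NNReal.rpow_add_le_mul_rpow_add_rpow 1 ‖ξ‖₊ hs
  rw [Real.one_rpow] at h2
  refine h2.trans ?_
  gcongr

/-- An elliptic symbol of order `s > 1` has an integrable inverse. -/
theorem integrable_inv_of_elliptic {P : ℝ → ℂ} (hP : Measurable P) {s c : ℝ} (hs : 1 < s)
    (hc : 0 < c) (h : ∀ ξ, c * (1 + ‖freq ξ‖ ^ s) ≤ ‖P ξ‖) : Integrable fun ξ => (P ξ)⁻¹ := by
  have := integrable_one_add_norm (E := ℝ) (μ := volume) (r := s) (by simpa)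
  refine (this.const_mul (2 ^ (s - 1) / c)).mono' hP.inv.aestronglyMeasurable
    (ae_of_all _ fun ξ => ?_)
  rw [norm_inv, Real.rpow_neg (by positivity), ← div_eq_mul_inv, div_div, Real.norm_eq_abs]
  have h1 := one_add_abs_rpow_le hs.le ξ
  have h2 : 0 < (1 + |ξ|) ^ s := by positivity
  have h3 : 0 < ‖P ξ‖ := lt_of_lt_of_le (by positivity) (h ξ)
  rw [le_div_iff₀ (by positivity), inv_mul_le_iff₀ h3]
  calc _ ≤ c * (2 ^ (s - 1) * (1 + ‖freq ξ‖ ^ s)) := by gcongr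
    _ = c * (1 + ‖freq ξ‖ ^ s) * 2 ^ (s - 1) := by ring
    _ ≤ _ := by
      gcongr
      exact h ξ

/-! ### Existence, uniqueness and smoothness of the solution -/

theorem plancherel_injective {u v : ℝ → ℝ} {hu : MemLp u 2 volume} {hv : MemLp v 2 volume}
    (h : plancherel hu = plancherel hv) : u =ᵐ[volume] v := by
  have h' := congrArg (fun z : Lp ℂ 2 (volume : Measure ℝ) => 𝓕⁻ z) h
  simp only [plancherel, FourierTransform.fourierInv_fourier_eq] at h'
  filter_upwards [(MemLp.toLp_eq_toLp_iff _ _).1 h'] with x hx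
  exact_mod_cast hx

open ComplexConjugate in
/-- Solvability with an elliptic symbol: the solution is `𝓕⁻ (𝓕 f / P)`, whose smoothness follows
since `1 / P` is a symbol of negative order. -/
theorem exists_contDiff_isSolution {p q a b μ c : ℝ} (hμ : μ ∈ Set.Ioo (0 : ℝ) 1) (hc : 0 < c)
    (hP : ∀ ξ, c * (1 + ‖freq ξ‖ ^ (2 - μ)) ≤ ‖opSymbol p q a b (2 - μ) ξ‖)
    {f : ℝ → ℝ} (hf : MemLp f 2 volume) (hfs : ContDiff ℝ ∞ f) :
    ∃ u : ℝ → ℝ, ContDiff ℝ ∞ u ∧ IsSolution p q a b μ f u ∧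
      ∃ hu : MemLp u 2 volume, ∀ᵐ ξ,
        plancherel hu ξ = (opSymbol p q a b (2 - μ) ξ)⁻¹ * plancherel hf ξ := by
  have hs : 1 < 2 - μ := by linarith [hμ.2]
  set P := opSymbol p q a b (2 - μ) with hPd
  have hw : ∀ ξ, 0 ≤ ‖freq ξ‖ ^ (2 - μ) := fun ξ => by positivity
  have hP0 : ∀ ξ, P ξ ≠ 0 := fun ξ => by
    have := hw ξ
    exact norm_pos_iff.1 (lt_of_lt_of_le (by positivity) (hP ξ))
  have hB : ∀ ξ, ‖(P ξ)⁻¹‖ ≤ c⁻¹ := fun ξ => by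
    rw [norm_inv]
    refine inv_anti₀ hc (le_trans ?_ (hP ξ))
    exact le_mul_of_one_le_right hc.le (by linarith [hw ξ])
  have hPc : Continuous P := continuous_opSymbol p q a b (by linarith)
  have hm : ∀ n, IsSymbol n 0 fun ξ => (P ξ)⁻¹ := fun n => by
    refine ((isSymbol_opSymbol n p q a b hs.le).inv hP0 hc fun ξ _ => (le_trans ?_ (hP ξ))).mono
      (by linarith)
    have h1 : |ξ| ≤ ‖freq ξ‖ := by
      rw [norm_freq]
      exact le_mul_of_one_le_left (abs_nonneg _) (by linarith [Real.pi_gt_three])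
    have : |ξ| ^ (2 - μ) ≤ ‖freq ξ‖ ^ (2 - μ) := by gcongr
    gcongr
    linarith
  have hU : MemLp (fun ξ => (P ξ)⁻¹ * plancherel hf ξ) 2 volume := by
    refine (Lp.memLp (plancherel hf)).of_le_mul (c := c⁻¹)
      ((hPc.inv₀ hP0).aestronglyMeasurable.mul (Lp.memLp _).1) (ae_of_all _ fun ξ => ?_)
    rw [norm_mul]
    gcongr
    exact hB ξ
  set U : Lp ℂ 2 (volume : Measure ℝ) := hU.toLp _ with hUd
  have hUe : U =ᵐ[volume] fun ξ => (P ξ)⁻¹ * plancherel hf ξ := hU.coeFn_toLp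
  obtain ⟨h, hh, he⟩ := exists_contDiff_fourierInv_of_isSymbol hm hB
    (integrable_inv_of_elliptic hPc.measurable hs hc hP) (hPc.inv₀ hP0) hf hfs hUe
  have hneg : ∀ᵐ ξ, U (-ξ) = conj (U ξ) := by
    have hUn := (Measure.measurePreserving_neg (volume : Measure ℝ)).quasiMeasurePreserving.ae hUe
    filter_upwards [hUe, hUn, plancherel_neg hf] with ξ h1 h2 h3
    rw [h1, h2, h3, hPd, opSymbol_neg, map_mul, map_inv₀]
  have him := Lp_fourierInv_im_eq_zero hneg
  have hre : (fun x => ((h x).re : ℂ)) =ᵐ[volume] (𝓕⁻ U : Lp ℂ 2 (volume : Measure ℝ)) := by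
    filter_upwards [he, him] with x h1 h2
    rw [← h1]
    exact Complex.ext (by simp) (by simp [h2])
  have hu : MemLp (fun x => (h x).re) 2 volume := by
    have := ((memLp_congr_ae hre).2 (Lp.memLp _)).re
    simpa using this
  have hpu : plancherel hu = U := by
    have : hu.ofReal.toLp (fun x => ((h x).re : ℂ)) = 𝓕⁻ U :=
      Lp.ext (hu.ofReal.coeFn_toLp.trans hre)
    rw [plancherel, this, FourierTransform.fourier_fourierInv_eq]
  have hue : ∀ᵐ ξ, plancherel hu ξ = (P ξ)⁻¹ * plancherel hf ξ := by rwa [hpu]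
  refine ⟨fun x => (h x).re, Complex.reCLM.contDiff.comp hh, ?_, hu, hue⟩
  refine isSolution_of_plancherel_eq hμ hf hu ?_ ?_
  · refine ((Lp.memLp (plancherel hf)).norm.integrable_sq.const_mul (c⁻¹ ^ 2)).mono' ?_ ?_
    · exact (Measurable.aestronglyMeasurable (by fun_prop)).mul ((Lp.memLp _).1.norm.pow 2)
    · filter_upwards [hue] with ξ hξ
      rw [Real.norm_of_nonneg (by positivity), hξ, norm_mul, mul_pow, ← mul_assoc, norm_inv,
        norm_two_pi_mul, mul_comm 2, Real.rpow_mul (norm_nonneg _), Real.rpow_two]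
      gcongr
      have h1 := hw ξ
      have h2 : 0 < ‖P ξ‖ := norm_pos_iff.2 (hP0 ξ)
      rw [inv_pow, inv_pow, ← div_eq_mul_inv, ← one_div, div_le_div_iff₀ (by positivity)
        (by positivity), one_mul, mul_comm]
      calc _ ≤ (c * (1 + ‖freq ξ‖ ^ (2 - μ))) ^ 2 := by
            rw [mul_pow]
            gcongr
            nlinarith
        _ ≤ _ := by
            gcongr
            exact hP ξ
  · filter_upwards [hue] with ξ hξ
    rw [hξ, mul_inv_cancel_left₀ (hP0 ξ)]

end
theorem mainTheorem4 (p q a b μ : ℝ) (hb : b ≠ 0) (hpq : p ^ 2 + q ^ 2 ≠ 0)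
    (hμ : μ ∈ Set.Ioo (0 : ℝ) 1) (hC : CoeffCondition p q a b μ)
    (f : ℝ → ℝ) (hf : MemLp f 2 volume) (hf_smooth : ContDiff ℝ ∞ f) :
    ∃ u : ℝ → ℝ, ContDiff ℝ ∞ u ∧ IsSolution p q a b μ f u ∧
      ∀ v : ℝ → ℝ, IsSolution p q a b μ f v → v =ᵐ[volume] u := by
  obtain ⟨c, hc, hP⟩ := exists_le_norm_opSymbol hb hpq hμ hC
  obtain ⟨u, hus, hsol, hu, hue⟩ := exists_contDiff_isSolution hμ hc hP hf hf_smooth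
  refine ⟨u, hus, hsol, fun v hv => ?_⟩
  obtain ⟨hvm, -⟩ := hv.1
  refine plancherel_injective (hu := hvm) (hv := hu) (Lp.ext ?_)
  filter_upwards [hv.plancherel_eq hμ hf hvm, hue] with ξ h1 h2
  have h0 : opSymbol p q a b (2 - μ) ξ ≠ 0 :=
    norm_pos_iff.1 (lt_of_lt_of_le (by positivity) (hP ξ))
  rw [h2, ← h1, inv_mul_cancel_left₀ h0]
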